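/- Let $N\ge 1$ and $d\ge 2$ be integers, $L=Nd$, $\rho=N/L=1/d$ and $r_0=\rho^\rho(1-\rho)^{1-\rho}$. Let $$\mathcal X_N(L)=\{(x_1,\dots,x_N)\in\mathbb Z^N:\ x_1<x_2<\cdots<x_N<x_1+L\}.$$ The TASEP in $\mathcal X_N(L)$ is the continuous-time Markov jump process in which each particle $i$ jumps from $x_i$ to $x_i+1$ at rate $1$, jumps leading outside $\mathcal X_N(L)$ being suppressed. For $0<|z|<r_0$ let $R_z$ be the set of roots of $q_z(w)=w^N(w+1)^{L-N}-z^L$, and put $R_{z,\mathrm{left}}=R_z\cap\{\operatorname{Re}w<-\rho\}$, $R_{z,\mathrm{right}}=R_z\cap\{\operatorname{Re}w>-\rho\}$, $q_{z,\mathrm{right}}(w)=\prod_{v\in R_{z,\mathrm{right}}}(w-v)$. For every such $z$ and every $u\in R_{z,\mathrm{left}}$ there is exactly one $v=v(u)\in R_{z,\mathrm{right}}$ with $v(v+1)^{d-1}=u(u+1)^{d-1}$, and the map $u\mapsto v(u)$ from $R_{z,\mathrm{left}}$ to $R_{z,\mathrm{right}}$ is $(d-1)$-to-$1$. Given $k\in\{1,\dots,N\}$,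 $t>0$ and $a\in\mathbb Z$, define $$\mathcal C_N^{(1)}(z)=\frac{\prod_{v\in R_{z,\mathrm{right}}}(v+1)^{-a+kd+L-N-d/2+1}\,(d(v+\rho))^{-1/2}\,e^{tv}}{\prod_{v\in R_{z,\mathrm{right}}}\prod_{u\in R_{z,\mathrm{left}}}\sqrt{v-u}},$$ where $\sqrt{\cdot}$ is the principal square root and $w^{n/2}=(\sqrt w)^n$ for $n\in\mathbb Z$. Let $$g(w)=\frac{w^{-N-k+2}(w+1)^{-a+k+d}e^{tw}}{w+\rho},\qquad f_1(w)=\begin{cases}q_{z,\mathrm{right}}(w)\,g(w),& w\in R_{z,\mathrm{left}},\\ q_{z,\mathrm{right}}'(w)\,g(w),& w\in R_{z,\mathrm{right}},\end{cases}$$ and let $K_z^{(1)}$ be the operator on $\ell^2(R_{z,\mathrm{left}})$ with kernel $$K_z^{(1)}(u,u')=\frac{f_1(u)}{(u-v')\,f_1(v')},\qquad v'=v(u').$$ Then for the TASEP in $\mathcal X_N(L)$ with flat initial condition $x_j(0)=jd$, $1\le j\le N$, for every $k\in\{1,\dots,N\}$, $t>0$ and $a\in\mathbb Z$, $$\mathbb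 P(x_k(t)\ge a)=\oint \mathcal C_N^{(1)}(z)\,\det\bigl(I+K_z^{(1)}\bigr)\,\frac{dz}{2\pi i z},$$ where the integrand is integrable along the contour, and the contour is any piecewise continuously differentiable simple closed curve, oriented counterclockwise, which encloses $0$ and lies in $0<|z|<r_0$. -/

import Mathlib

open MeasureTheory ProbabilityTheory
open scoped NNReal

noncomputable section

namespace PeriodicTASEP

/-! ### The particle system -/

/-- The configuration space of `N` particles with period `L`: the integer vectors with
`x₁ < x₂ < ⋯ < x_N < x₁ + L`. For an increasing vector the last inequality is the same as
`x j < x i + L` for all `i, j`. -/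
def Config (N L : ℕ) : Set (Fin N → ℤ) :=
  {x | StrictMono x ∧ ∀ i j, x j < x i + L}

open Classical in
/-- The generator of the TASEP: every particle `i` jumps one step to the right at rate `1`,
provided that the new vector is again a configuration; otherwise the jump is suppressed. -/
def generator {N L : ℕ} (f : Config N L → ℝ) (x : Config N L) : ℝ :=
  ∑ i : Fin N,
    if h : Function.update x.1 i (x.1 i + 1) ∈ Config N L then f ⟨_, h⟩ - f x else 0

/-- `X` is a continuous-time TASEP in `Config N L` with respect to the filtration `ℱ`: it is
adapted, its paths are right-continuous step functions with left limits (the configuration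
space is discrete), and it solves the martingale problem for the generator, that is,
`f (X t) - ∫₀ᵗ (generator f) (X s) ds` is a martingale for every bounded `f`.
The generator is bounded, so this determines the law of `X` given `X 0`: it is the Markov jump
process in which each particle jumps at rate `1` whenever the target is allowed. -/
structure IsTASEP {N L : ℕ} {Ω : Type*} {m : MeasurableSpace Ω} (μ : Measure Ω)
    (ℱ : Filtration ℝ≥0 m) (X : ℝ≥0 → Ω → Config N L) : Prop where
  adapted : ∀ t, Measurable[ℱ t] (X t)
  right_continuous : ∀ ω t, ∀ᶠ s in nhdsWithin t (Set.Ioi t), X s ω = X t ω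
  left_limits : ∀ ω t, ∃ c, ∀ᶠ s in nhdsWithin t (Set.Iio t), X s ω = c
  martingale : ∀ f : Config N L → ℝ, (∃ C, ∀ x, |f x| ≤ C) →
    Martingale (fun (t : ℝ≥0) ω =>
      f (X t ω) - ∫ s in (0 : ℝ)..(t : ℝ), generator f (X s.toNNReal ω)) ℱ μ

/-! ### Contour integrals -/

/-- The one-form `f(z) dz / (2 π i z)`. -/
def logForm (f : ℂ → ℂ) : ℂ → ℂ →L[ℂ] ℂ := fun z =>
  (f z / (2 * Real.pi * Complex.I * z)) • ContinuousLinearMap.id ℂ ℂ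

/-- A closed path that is a simple, piecewise continuously differentiable contour in the punctured
disc `0 < |z| < r`, with `0` inside and counterclockwise orientation. A simple closed curve
avoiding `0` has winding number `0`, `1` or `-1` around `0`, and the winding number is `1` exactly
if the curve encloses `0` and is oriented counterclockwise. -/
structure IsContourAroundZero (r : ℝ) {p : ℂ} (γ : Path p p) : Prop where
  simple : ∀ s s' : unitInterval, γ s = γ s' → s = s' ∨ (s = 0 ∧ s' = 1) ∨ (s = 1 ∧ s' = 0)
  piecewise_C1 : ∃ (n : ℕ) (τ : Fin (n + 1) → ℝ), StrictMono τ ∧ τ 0 = 0 ∧ τ (Fin.last n) = 1 ∧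
    ∀ i : Fin n, ContDiffOn ℝ 1 γ.extend (Set.Icc (τ i.castSucc) (τ i.succ))
  mem : ∀ s, 0 < ‖γ s‖ ∧ ‖γ s‖ < r
  winding : curveIntegral (logForm fun _ => 1) γ = 1

/-! ### Bethe roots -/

/-- The density `ρ = N / L`. -/
def density (N L : ℕ) : ℝ := (N : ℝ) / L

/-- `r₀ = ρ^ρ (1 - ρ)^(1 - ρ)`. -/
def criticalRadius (N L : ℕ) : ℝ :=
  density N L ^ density N L * (1 - density N L) ^ (1 - density N L)

/-- `q_z(w) = w^N (w + 1)^(L - N) - z^L`. -/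
def bethePoly (N L : ℕ) (z : ℂ) : Polynomial ℂ :=
  Polynomial.X ^ N * (Polynomial.X + 1) ^ (L - N) - Polynomial.C (z ^ L)

/-- The roots of `q_z` in the half plane `Re w < -ρ`. -/
def leftRoots (N L : ℕ) (z : ℂ) : Finset ℂ :=
  (bethePoly N L z).roots.toFinset.filter fun w => w.re < -density N L

/-- The roots of `q_z` in the half plane `Re w > -ρ`. -/
def rightRoots (N L : ℕ) (z : ℂ) : Finset ℂ :=
  (bethePoly N L z).roots.toFinset.filter fun w => -density N L < w.re

/-- `q_{z,right}(w) = ∏_v (w - v)` over the right roots `v`. -/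
def rightPoly (N L : ℕ) (z : ℂ) : Polynomial ℂ :=
  ∏ v ∈ rightRoots N L z, (Polynomial.X - Polynomial.C v)

/-! ### The formula for the flat initial condition, with `L = N d` -/

/-- `V(u)`: the right roots `v` with `v (v + 1)^(d - 1) = u (u + 1)^(d - 1)`. -/
def flatFiber (N d : ℕ) (z u : ℂ) : Finset ℂ :=
  (rightRoots N (N * d) z).filter fun v => v * (v + 1) ^ (d - 1) = u * (u + 1) ^ (d - 1)

/-- The element of `V(u)` (which is unique for a left root `u`). -/
def flatPartner (N d : ℕ) (z u : ℂ) : ℂ :=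
  Classical.epsilon fun v => v ∈ flatFiber N d z u

/-- The function `f₁` on the roots of `q_z`; here `ρ⁻¹ = d`. -/
def flatWeight (N d : ℕ) (k a : ℤ) (t : ℝ) (z w : ℂ) : ℂ :=
  (if w ∈ leftRoots N (N * d) z then (rightPoly N (N * d) z).eval w
    else (rightPoly N (N * d) z).derivative.eval w) *
    w ^ (-(N : ℤ) - k + 2) * (w + 1) ^ (-a + k + (d : ℤ)) * Complex.exp (t * w) /
    (w + density N (N * d))

/-- The kernel `K_z(u, u') = f₁(u) / ((u - v') f₁(v'))` on the left roots, where `v'` is the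
element of `V(u')`. -/
def flatKernel (N d : ℕ) (k a : ℤ) (t : ℝ) (z : ℂ) :
    Matrix (leftRoots N (N * d) z) (leftRoots N (N * d) z) ℂ :=
  Matrix.of fun u u' =>
    flatWeight N d k a t z u /
      ((u - flatPartner N d z u') * flatWeight N d k a t z (flatPartner N d z u'))

/-- The factor `C_N(z)`. Half-integer powers `w^(n/2)` are read as `(√w)^n`, with the principal
square root. -/
def flatConst (N d : ℕ) (k a : ℤ) (t : ℝ) (z : ℂ) : ℂ :=
  (∏ v ∈ rightRoots N (N * d) z,
    Complex.sqrt (v + 1) ^ (2 * (-a + k * d + ((N * d : ℕ) : ℤ) - N + 1) - (d : ℤ)) *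
      (Complex.sqrt (d * (v + density N (N * d))))⁻¹ * Complex.exp (t * v)) /
    ∏ v ∈ rightRoots N (N * d) z, ∏ u ∈ leftRoots N (N * d) z, Complex.sqrt (v - u)

end PeriodicTASEP

end

/-!
The probability `P(x_k(t) ≥ a)` is computed from the backward equation, which is solved by the Bethe
ansatz.

The martingale problem gives Dynkin's formula, and iterating it shows that the expectation of a
bounded function `f` of `X_t` is the exponential series `∑ t ^ m / m! * (generator^[m] f) (X_0)`
(`IsTASEP.hasSum_generator_iterate`; the generator is bounded). The generator commutes with the
cyclic relabelling `rotate`, so it suffices to treat the event that the first particle has reached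
`a`, started from a relabelled configuration `y`.

For this event the solution is the contour mean of the determinant `waveDet`, whose entries are sums
over the roots of `q_z`. Expanded by columns it is a sum over choices of one root `W j` for every
particle. A free jump of particle `i` multiplies the summand by `W i + 1`, and a suppressed jump
contributes nothing because the summand is then antisymmetric in the roots of two particles; for the
last and the first particle this uses the Bethe equation `w ^ N * (w + 1) ^ (L - N) = z ^ L`
(`waveCoeff_succ`). At time `0` the mean is the indicator of the event
(`hasContourMean_det_betheMoment`): sums over the roots of `q_z` are Laurent polynomials in `z ^ L`,
and the determinant is either a polynomial in `z ^ L` with constant term `1`, or a polynomial in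
`z ^ (-L)` with constant term `0`. Only `∮ z ^ m dz / z = 0` for `m ≠ 0` and the winding number of
the contour are used.

For the flat initial condition, the roots are grouped by the `N` values `θ` of `w (w + 1) ^ (d - 1)`.
For each `θ` there are one right root and `d - 1` left roots, which are obtained as fixed points of
contractions of two half planes (`exists_rightBranch`, `exists_leftBranch`). The matrix of `waveDet`
factors through the Vandermonde matrix of the `θ`. What remains has, for each `θ`, a column which is
the sum of the terms of a right root and of its left partners. Lagrange interpolation at the right
roots turns the left terms into the Fredholm determinant of the kernel (`det_add_left`), and the
right terms give the prefactor (`flatConst_eq`). There the Vandermonde determinants have to be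
identified with a product of principal square roots. The squares agree by factoring
`w (w + 1) ^ (d - 1) - θ`, and the sign is determined by following the roots continuously to `θ = 0`
(`prod_csqrt_eq`).
-/


namespace PeriodicTASEP

/-! ### From the martingale problem to the exponential series of the generator -/

section Markov

open Filter Topology

variable {N L : ℕ}

lemma measurable_config {β : Type*} [MeasurableSpace β] (f : Config N L → β) : Measurable f :=
  measurable_of_countable f

open Classical in
lemma abs_generator_le {f : Config N L → ℝ} {C : ℝ} (hf : ∀ x, |f x| ≤ C) (x : Config N L) :
    |generator f x| ≤ 2 * N * C := by
  have hC : 0 ≤ C := (abs_nonneg _).trans (hf x)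
  unfold generator
  refine (Finset.abs_sum_le_sum_abs _ _).trans ?_
  have : ∀ i ∈ (Finset.univ : Finset (Fin N)),
      |if h : Function.update x.1 i (x.1 i + 1) ∈ Config N L then f ⟨_, h⟩ - f x else 0| ≤
        2 * C := by
    intro i _
    split_ifs with h
    · have h1 := hf ⟨_, h⟩
      have h2 := hf x
      rw [abs_le] at *
      constructor <;> linarith
    · simpa using hC
  refine (Finset.sum_le_sum this).trans (le_of_eq ?_)
  simp
  ring

variable {Ω : Type*} {m : MeasurableSpace Ω} {μ : Measure Ω}
  {ℱ : Filtration ℝ≥0 m} {X : ℝ≥0 → Ω → Config N L}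

/-- A right-continuous process is jointly measurable: it is the limit of the processes which are
sampled at the next point of the grid of mesh `1 / (n + 1)`. -/
lemma IsTASEP.measurable_uncurry (hX : IsTASEP μ ℱ X) (g : Config N L → ℝ) :
    Measurable fun p : ℝ × Ω => g (X p.1.toNNReal p.2) := by
  have key : Measurable fun p : ℝ≥0 × Ω => g (X p.1 p.2) := by
    let s : ℕ → ℝ≥0 → ℝ≥0 := fun n t => ((⌊t * (n + 1)⌋₊ + 1 : ℕ) : ℝ≥0) / (n + 1)
    have hs_gt : ∀ n t, t < s n t := by
      intro n t
      have hpos : (0 : ℝ≥0) < n + 1 := by positivity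
      rw [lt_div_iff₀ hpos]
      exact_mod_cast Nat.lt_floor_add_one _
    have hs_le : ∀ n t, s n t ≤ t + 1 / ((n : ℝ≥0) + 1) := by
      intro n t
      have hpos : (0 : ℝ≥0) < n + 1 := by positivity
      have h1 : ((⌊t * (n + 1)⌋₊ : ℕ) : ℝ≥0) ≤ t * (n + 1) := Nat.floor_le zero_le
      have h2 : t + 1 / ((n : ℝ≥0) + 1) = (t * (n + 1) + 1) / (n + 1) := by
        field_simp
      rw [h2]
      simp only [s]
      push_cast
      gcongr
    have hs_lim : ∀ t, Tendsto (fun n => s n t) atTop (𝓝[>] t) := by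
      intro t
      refine tendsto_nhdsWithin_iff.2 ⟨?_, Eventually.of_forall fun n => hs_gt n t⟩
      have h0 : Tendsto (fun n : ℕ => t + 1 / ((n : ℝ≥0) + 1)) atTop (𝓝 (t + 0)) :=
        tendsto_const_nhds.add tendsto_one_div_add_atTop_nhds_zero_nat
      rw [add_zero] at h0
      exact tendsto_of_tendsto_of_tendsto_of_le_of_le tendsto_const_nhds h0
        (fun n => (hs_gt n t).le) (fun n => hs_le n t)
    refine measurable_of_tendsto_metrizable (f := fun n (p : ℝ≥0 × Ω) => g (X (s n p.1) p.2))
      (fun n => ?_) ?_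
    · have h1 : Measurable fun q : ℕ × Ω => g (X (((q.1 + 1 : ℕ) : ℝ≥0) / (n + 1)) q.2) :=
        measurable_from_prod_countable_right fun k =>
          (measurable_config g).comp
            ((hX.adapted (((k + 1 : ℕ) : ℝ≥0) / (n + 1))).mono (ℱ.le _) le_rfl)
      have h2 : Measurable fun p : ℝ≥0 × Ω => (⌊p.1 * (n + 1)⌋₊, p.2) :=
        (Nat.measurable_floor.comp (measurable_fst.mul_const _)).prodMk measurable_snd
      exact h1.comp h2
    · rw [tendsto_pi_nhds]
      rintro ⟨t, ω⟩
      refine tendsto_const_nhds.congr' ?_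
      filter_upwards [(hs_lim t).eventually (hX.right_continuous ω t)] with n hn
      simp only [hn]
  exact key.comp (measurable_real_toNNReal.prodMap measurable_id)

variable [IsProbabilityMeasure μ]

/-- Dynkin's formula. -/
lemma IsTASEP.integral_eq (hX : IsTASEP μ ℱ X) {x₀ : Config N L} (h0 : ∀ᵐ ω ∂μ, X 0 ω = x₀)
    {f : Config N L → ℝ} {C : ℝ} (hf : ∀ x, |f x| ≤ C) (t : ℝ≥0) :
    ∫ ω, f (X t ω) ∂μ =
      f x₀ + ∫ s in (0 : ℝ)..t, ∫ ω, generator f (X s.toNNReal ω) ∂μ := by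
  have hM := hX.martingale f ⟨C, hf⟩
  have h1 := hM.setIntegral_eq (zero_le (a := t)) (MeasurableSet.univ (m := ℱ 0))
  simp only [Measure.restrict_univ, NNReal.coe_zero, intervalIntegral.integral_same,
    sub_zero] at h1
  have h2 : ∫ ω, f (X 0 ω) ∂μ = f x₀ := by
    rw [integral_congr_ae (g := fun _ => f x₀)]
    · simp
    · filter_upwards [h0] with ω hω
      rw [hω]
  have hint : Integrable (fun ω => f (X t ω)) μ := by
    refine Integrable.of_bound (C := C) ?_ (Eventually.of_forall fun ω => hf _)
    exact ((measurable_config f).comp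
      ((hX.adapted t).mono (ℱ.le t) le_rfl)).aestronglyMeasurable
  have hprod : Integrable (Function.uncurry fun (s : ℝ) ω => generator f (X s.toNNReal ω))
      ((volume.restrict (Set.uIoc (0 : ℝ) t)).prod μ) := by
    have : IsFiniteMeasure (volume.restrict (Set.uIoc (0 : ℝ) t)) :=
      ⟨by simp [Set.uIoc]⟩
    refine Integrable.of_bound (C := 2 * N * C) ?_
      (Eventually.of_forall fun p => abs_generator_le hf _)
    exact (hX.measurable_uncurry (generator f)).aestronglyMeasurable
  have hint2 : Integrable (fun ω => ∫ s in (0 : ℝ)..t, generator f (X s.toNNReal ω)) μ := by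
    exact (hint.sub (hM.integrable t)).congr (Eventually.of_forall fun ω => by simp)
  rw [integral_sub hint hint2, h2] at h1
  rw [intervalIntegral_integral_swap hprod]
  linarith

lemma IsTASEP.intervalIntegrable (hX : IsTASEP μ ℱ X) {f : Config N L → ℝ} {C : ℝ}
    (hf : ∀ x, |f x| ≤ C) (a b : ℝ) :
    IntervalIntegrable (fun s : ℝ => ∫ ω, f (X s.toNNReal ω) ∂μ) volume a b := by
  have hm : StronglyMeasurable fun s : ℝ => ∫ ω, f (X s.toNNReal ω) ∂μ :=
    (hX.measurable_uncurry f).stronglyMeasurable.integral_prod_right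
  rw [intervalIntegrable_iff]
  refine Measure.integrableOn_of_bounded (M := C) (by simp [Set.uIoc])
    hm.aestronglyMeasurable (Eventually.of_forall fun s => ?_)
  refine (norm_integral_le_of_norm_le_const (Eventually.of_forall fun ω => hf _)).trans ?_
  simp

/-- Taylor expansion with remainder, obtained by iterating Dynkin's formula. -/
lemma IsTASEP.abs_integral_sub_sum_le (hX : IsTASEP μ ℱ X) {x₀ : Config N L}
    (h0 : ∀ᵐ ω ∂μ, X 0 ω = x₀) (n : ℕ) {f : Config N L → ℝ} {C : ℝ}
    (hf : ∀ x, |f x| ≤ C) (t : ℝ≥0) :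
    |∫ ω, f (X t ω) ∂μ - ∑ i ∈ Finset.range n, (t : ℝ) ^ i / i.factorial * generator^[i] f x₀| ≤
      C * ((2 * N * t) ^ n / n.factorial) := by
  induction n generalizing f C t with
  | zero =>
    simp only [Finset.range_zero, Finset.sum_empty, sub_zero, pow_zero, Nat.factorial_zero,
      Nat.cast_one, div_one, mul_one]
    rw [← Real.norm_eq_abs]
    refine (norm_integral_le_of_norm_le_const (C := C) (Eventually.of_forall fun ω => hf _)).trans ?_
    simp
  | succ n ih =>
    have hg := abs_generator_le hf
    have hpow : ∀ i : ℕ, ∫ s in (0 : ℝ)..t, s ^ i / i.factorial * generator^[i] (generator f) x₀ =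
        (t : ℝ) ^ (i + 1) / (i + 1).factorial * generator^[i + 1] f x₀ := by
      intro i
      rw [intervalIntegral.integral_mul_const, intervalIntegral.integral_div, integral_pow,
        Function.iterate_succ_apply, Nat.factorial_succ]
      push_cast
      field_simp
      simp
    have hsum : ∑ i ∈ Finset.range (n + 1), (t : ℝ) ^ i / i.factorial * generator^[i] f x₀ =
        f x₀ + ∫ s in (0 : ℝ)..t, ∑ i ∈ Finset.range n,
          s ^ i / i.factorial * generator^[i] (generator f) x₀ := by
      rw [Finset.sum_range_succ', intervalIntegral.integral_finsetSum]
      · simp only [hpow]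
        simp [add_comm]
      · intro i _
        exact Continuous.intervalIntegrable (by fun_prop) _ _
    have hI1 := hX.intervalIntegrable hg 0 t
    have hI2 : IntervalIntegrable (fun s : ℝ => ∑ i ∈ Finset.range n,
          s ^ i / i.factorial * generator^[i] (generator f) x₀) volume 0 t :=
      Continuous.intervalIntegrable (by fun_prop) _ _
    rw [hsum, hX.integral_eq h0 hf, add_sub_add_left_eq_sub,
      ← intervalIntegral.integral_sub hI1 hI2]
    have hbound : ∀ s ∈ Set.Ioc (0 : ℝ) t,
        ‖∫ ω, generator f (X s.toNNReal ω) ∂μ -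
          ∑ i ∈ Finset.range n, s ^ i / i.factorial * generator^[i] (generator f) x₀‖ ≤
        2 * N * C * ((2 * N * s) ^ n / n.factorial) := by
      intro s hs
      have := ih hg s.toNNReal
      rwa [Real.coe_toNNReal s hs.1.le] at this
    rw [← Real.norm_eq_abs]
    refine (intervalIntegral.norm_integral_le_of_norm_le t.2
      (Eventually.of_forall hbound) (Continuous.intervalIntegrable (by fun_prop) _ _)).trans
      (le_of_eq ?_)
    have : ∀ s : ℝ, 2 * N * C * ((2 * N * s) ^ n / n.factorial) =
        s ^ n * (2 * N * C * (2 * N) ^ n / n.factorial) := by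
      intro s
      rw [mul_pow]
      ring
    simp only [this]
    rw [intervalIntegral.integral_mul_const, integral_pow, Nat.factorial_succ]
    push_cast
    field_simp
    simp
    ring

/-- The expectation of a bounded function of the process is the exponential series of the
(bounded) generator. -/
theorem IsTASEP.hasSum_generator_iterate (hX : IsTASEP μ ℱ X) {x₀ : Config N L}
    (h0 : ∀ᵐ ω ∂μ, X 0 ω = x₀) {f : Config N L → ℝ} {C : ℝ} (hf : ∀ x, |f x| ≤ C)
    (t : ℝ≥0) {S : ℝ}
    (hS : HasSum (fun n : ℕ => (t : ℝ) ^ n / n.factorial * generator^[n] f x₀) S) :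
    ∫ ω, f (X t ω) ∂μ = S := by
  refine tendsto_nhds_unique ?_ hS.tendsto_sum_nat
  rw [tendsto_iff_norm_sub_tendsto_zero]
  have h1 : Tendsto (fun n : ℕ => C * ((2 * N * (t : ℝ)) ^ n / n.factorial)) atTop (𝓝 (C * 0)) :=
    (FloorSemiring.tendsto_pow_div_factorial_atTop _).const_mul C
  rw [mul_zero] at h1
  refine squeeze_zero (fun _ => norm_nonneg _) (fun n => ?_) h1
  rw [norm_sub_rev]
  exact hX.abs_integral_sub_sum_le h0 n hf t

end Markov

/-! ### Cyclic relabelling of the particles -/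

section Rotation

variable {N L : ℕ}

lemma mem_config_iff {x : Fin N → ℤ} (hL : 1 ≤ L) :
    x ∈ Config N L ↔ ∀ i j, i < j → x i < x j ∧ x j < x i + L := by
  constructor
  · rintro ⟨h1, h2⟩ i j hij
    exact ⟨h1 hij, h2 i j⟩
  · intro h
    refine ⟨fun i j hij => (h i j hij).1, fun i j => ?_⟩
    rcases lt_trichotomy i j with hij | rfl | hij
    · exact (h i j hij).2
    · omega
    · have := (h j i hij).1
      omega

/-- Relabelling of the particles: the first one becomes, moved by the period, the last one. -/
def rotateFun (L : ℕ) (x : Fin (N + 1) → ℤ) : Fin (N + 1) → ℤ :=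
  Fin.snoc (fun i : Fin N => x i.succ) (x 0 + L)

lemma rotateFun_castSucc (x : Fin (N + 1) → ℤ) (i : Fin N) :
    rotateFun L x i.castSucc = x i.succ := by simp [rotateFun]

lemma rotateFun_last (x : Fin (N + 1) → ℤ) : rotateFun L x (Fin.last N) = x 0 + L := by
  simp [rotateFun]

lemma rotateFun_mem_iff (hL : 1 ≤ L) (x : Fin (N + 1) → ℤ) :
    rotateFun L x ∈ Config (N + 1) L ↔ x ∈ Config (N + 1) L := by
  rw [mem_config_iff hL, mem_config_iff hL]
  constructor
  · intro h i j hij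
    obtain ⟨j, rfl⟩ := Fin.exists_succ_eq.2 (Fin.ne_zero_of_lt hij)
    cases i using Fin.cases with
    | zero =>
      have := h _ _ (Fin.castSucc_lt_last j)
      rw [rotateFun_castSucc, rotateFun_last] at this
      omega
    | succ i =>
      have := h i.castSucc j.castSucc (by simpa using hij)
      rwa [rotateFun_castSucc, rotateFun_castSucc] at this
  · intro h i j hij
    obtain ⟨i, rfl⟩ := Fin.exists_castSucc_eq.2 (Fin.ne_last_of_lt hij)
    cases j using Fin.lastCases with
    | last =>
      have := h 0 i.succ (Fin.succ_pos i)
      rw [rotateFun_castSucc, rotateFun_last]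
      omega
    | cast j =>
      have := h i.succ j.succ (by simpa using hij)
      rwa [rotateFun_castSucc, rotateFun_castSucc]

lemma rotateFun_update_succ (x : Fin (N + 1) → ℤ) (i : Fin N) (c : ℤ) :
    rotateFun L (Function.update x i.succ c) = Function.update (rotateFun L x) i.castSucc c := by
  ext j
  cases j using Fin.lastCases with
  | last => simp [rotateFun_last, (Fin.succ_ne_zero i).symm,
      (Fin.castSucc_lt_last i).ne']
  | cast j => simp [rotateFun_castSucc, Function.update_apply]

lemma rotateFun_update_zero (x : Fin (N + 1) → ℤ) (c : ℤ) :
    rotateFun L (Function.update x 0 c) =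
      Function.update (rotateFun L x) (Fin.last N) (c + L) := by
  ext j
  cases j using Fin.lastCases with
  | last => simp [rotateFun_last]
  | cast j => simp [rotateFun_castSucc, Fin.succ_ne_zero,
      (Fin.castSucc_lt_last j).ne]

/-- `rotateFun` on configurations. -/
def rotate (hL : 1 ≤ L) (x : Config (N + 1) L) : Config (N + 1) L :=
  ⟨rotateFun L x.1, (rotateFun_mem_iff hL x.1).2 x.2⟩

/-- The dynamics does not see the labels: particle `0` blocks the last particle just as every other
particle blocks its predecessor. -/
lemma generator_comp_rotate (hL : 1 ≤ L) (g : Config (N + 1) L → ℝ) :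
    generator (g ∘ rotate hL) = generator g ∘ rotate hL := by
  classical
  funext x
  simp only [generator, Function.comp]
  rw [Fin.sum_univ_succ, Fin.sum_univ_castSucc, add_comm]
  congr 1
  · refine Finset.sum_congr rfl fun i _ => ?_
    have h1 : rotateFun L (Function.update x.1 i.succ (x.1 i.succ + 1)) =
        Function.update (rotate hL x).1 i.castSucc ((rotate hL x).1 i.castSucc + 1) := by
      rw [rotateFun_update_succ]
      simp [rotate, rotateFun_castSucc]
    have h2 := rotateFun_mem_iff hL (Function.update x.1 i.succ (x.1 i.succ + 1))
    by_cases h : Function.update x.1 i.succ (x.1 i.succ + 1) ∈ Config (N + 1) L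
    · rw [dif_pos h, dif_pos (h1 ▸ h2.2 h)]
      congr 2
      exact Subtype.ext h1
    · rw [dif_neg h, dif_neg (fun h' => h (h2.1 (h1 ▸ h')))]
  · have h1 : rotateFun L (Function.update x.1 0 (x.1 0 + 1)) =
        Function.update (rotate hL x).1 (Fin.last N) ((rotate hL x).1 (Fin.last N) + 1) := by
      rw [rotateFun_update_zero]
      simp [rotate, rotateFun_last, add_right_comm]
    have h2 := rotateFun_mem_iff hL (Function.update x.1 0 (x.1 0 + 1))
    by_cases h : Function.update x.1 0 (x.1 0 + 1) ∈ Config (N + 1) L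
    · rw [dif_pos h, dif_pos (h1 ▸ h2.2 h)]
      congr 2
      exact Subtype.ext h1
    · rw [dif_neg h, dif_neg (fun h' => h (h2.1 (h1 ▸ h')))]

lemma generator_iterate_comp_rotate (hL : 1 ≤ L) (n k : ℕ) (g : Config (N + 1) L → ℝ) :
    generator^[n] (g ∘ (rotate hL)^[k]) = (generator^[n] g) ∘ (rotate hL)^[k] := by
  induction k generalizing g with
  | zero => simp
  | succ k ih =>
    have h1 : ∀ g : Config (N + 1) L → ℝ,
        generator^[n] (g ∘ rotate hL) = generator^[n] g ∘ rotate hL := by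
      intro g
      clear ih
      induction n with
      | zero => simp
      | succ n ihn =>
        rw [Function.iterate_succ_apply', ihn, generator_comp_rotate, Function.iterate_succ_apply']
    rw [Function.iterate_succ, ← Function.comp_assoc, h1, ih, Function.comp_assoc]

/-- The position of particle `j`, extended to all `j` by `x_{j + N} = x_j + L`, is shifted by
`k` labels when the relabelling is applied `k` times. -/
lemma rotate_iterate_apply (hL : 1 ≤ L) (x : Config (N + 1) L) (k : ℕ) (hk : k ≤ N)
    (j : Fin (N + 1)) :
    ((rotate hL)^[k] x).1 j =
      if h : j + k < N + 1 then x.1 ⟨j + k, h⟩ else x.1 ⟨j + k - (N + 1), by omega⟩ + L := by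
  induction k generalizing j with
  | zero => rw [dif_pos (by omega)]; rfl
  | succ k ih =>
    rw [Function.iterate_succ_apply']
    cases j using Fin.lastCases with
    | last =>
      have : ((rotate hL) ((rotate hL)^[k] x)).1 (Fin.last N) =
          ((rotate hL)^[k] x).1 0 + L := rotateFun_last _
      rw [this, ih (by omega)]
      rw [dif_pos (by simp; omega), dif_neg (by simp)]
      have hj : (⟨((0 : Fin (N + 1)) : ℕ) + k, by simp; omega⟩ : Fin (N + 1)) =
          ⟨((Fin.last N : Fin (N + 1)) : ℕ) + (k + 1) - (N + 1), by simp; omega⟩ := by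
        ext
        simp
        omega
      rw [hj]
    | cast j =>
      have : ((rotate hL) ((rotate hL)^[k] x)).1 j.castSucc =
          ((rotate hL)^[k] x).1 j.succ := rotateFun_castSucc _ _
      rw [this, ih (by omega)]
      simp only [Fin.val_succ, Fin.val_castSucc, add_assoc, add_comm 1 k]

end Rotation

/-! ### Contour integrals of Laurent polynomials -/

section Contour

variable {r : ℝ} {p : ℂ} {γ : Path p p}

lemma curveIntegralFun_logForm (f : ℂ → ℂ) (γ : Path p p) (s : ℝ) :
    curveIntegralFun (logForm f) γ s =
      f (γ.extend s) * curveIntegralFun (logForm fun _ => 1) γ s := by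
  simp only [curveIntegralFun_def, logForm, smul_apply, ContinuousLinearMap.id_apply,
    smul_eq_mul]
  ring

lemma curveIntegral_logForm (f : ℂ → ℂ) (γ : Path p p) :
    curveIntegral (logForm f) γ =
      ∫ s in (0 : ℝ)..1, f (γ.extend s) * curveIntegralFun (logForm fun _ => 1) γ s := by
  rw [curveIntegral_def]
  simp only [curveIntegralFun_logForm f]

/-- The form `dz / (2 π i z)` is integrable along the contour, as its integral is not `0`. -/
lemma IsContourAroundZero.intervalIntegrable (hγ : IsContourAroundZero r γ) :
    IntervalIntegrable (curveIntegralFun (logForm fun _ => 1) γ) volume 0 1 := by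
  by_contra h
  have h1 := hγ.winding
  rw [curveIntegral_def, intervalIntegral.integral_undef h] at h1
  exact zero_ne_one h1

lemma extend_mem_range (γ : Path p p) (s : ℝ) : γ.extend s ∈ Set.range γ := by
  rw [← Path.extend_range]
  exact Set.mem_range_self s

lemma continuous_comp_extend {f : ℂ → ℂ} (hf : ContinuousOn f (Set.range γ)) :
    Continuous fun s : ℝ => f (γ.extend s) := by
  exact hf.comp_continuous γ.continuous_extend (extend_mem_range γ)

lemma IsContourAroundZero.curveIntegrable (hγ : IsContourAroundZero r γ) {f : ℂ → ℂ}
    (hf : ContinuousOn f (Set.range γ)) : CurveIntegrable (logForm f) γ := by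
  unfold CurveIntegrable
  simp only [funext (curveIntegralFun_logForm f γ)]
  exact hγ.intervalIntegrable.continuousOn_mul (continuous_comp_extend hf).continuousOn

/-- `f` is continuous on the contour `γ` and its mean `∮ f(z) dz / (2 π i z)` is `c`. -/
def HasContourMean (γ : Path p p) (f : ℂ → ℂ) (c : ℂ) : Prop :=
  ContinuousOn f (Set.range γ) ∧ curveIntegral (logForm f) γ = c

lemma HasContourMean.congr {f g : ℂ → ℂ} {c : ℂ} (h : HasContourMean γ f c)
    (hfg : ∀ s, g (γ s) = f (γ s)) : HasContourMean γ g c := by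
  have hfg' : Set.EqOn g f (Set.range γ) := by
    rintro _ ⟨s, rfl⟩
    exact hfg s
  refine ⟨h.1.congr hfg', ?_⟩
  rw [← h.2, curveIntegral_logForm, curveIntegral_logForm]
  congr 1
  funext s
  rw [hfg' (extend_mem_range γ s)]

lemma HasContourMean.add (hγ : IsContourAroundZero r γ) {f g : ℂ → ℂ} {c c' : ℂ}
    (hf : HasContourMean γ f c) (hg : HasContourMean γ g c') :
    HasContourMean γ (fun z => f z + g z) (c + c') := by
  refine ⟨hf.1.add hg.1, ?_⟩
  rw [← hf.2, ← hg.2, ← curveIntegral_fun_add (hγ.curveIntegrable hf.1) (hγ.curveIntegrable hg.1)]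
  congr 1
  funext z
  simp only [logForm, ← add_smul, add_div]

lemma HasContourMean.const_mul {f : ℂ → ℂ} {c : ℂ} (hf : HasContourMean γ f c) (a : ℂ) :
    HasContourMean γ (fun z => a * f z) (a * c) := by
  refine ⟨hf.1.const_mul a, ?_⟩
  rw [← hf.2, ← smul_eq_mul a, ← curveIntegral_fun_smul]
  congr 1
  funext z
  simp only [logForm, smul_smul, mul_div_assoc]

lemma HasContourMean.sub (hγ : IsContourAroundZero r γ) {f g : ℂ → ℂ} {c c' : ℂ}
    (hf : HasContourMean γ f c) (hg : HasContourMean γ g c') :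
    HasContourMean γ (fun z => f z - g z) (c - c') := by
  have := hf.add hγ (hg.const_mul (-1))
  simpa [sub_eq_add_neg] using this

lemma hasContourMean_zero : HasContourMean γ (fun _ => 0) 0 := by
  refine ⟨continuousOn_const, ?_⟩
  simp [curveIntegral_logForm]

lemma HasContourMean.sum (hγ : IsContourAroundZero r γ) {ι : Type*} (s : Finset ι)
    {f : ι → ℂ → ℂ} {c : ι → ℂ} (h : ∀ i ∈ s, HasContourMean γ (f i) (c i)) :
    HasContourMean γ (fun z => ∑ i ∈ s, f i z) (∑ i ∈ s, c i) := by
  classical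
  induction s using Finset.induction_on with
  | empty => simpa using hasContourMean_zero
  | insert i s hi ih =>
    simp only [Finset.sum_insert hi]
    exact (h i (Finset.mem_insert_self i s)).add hγ
      (ih fun j hj => h j (Finset.mem_insert_of_mem hj))

/-- A series which is dominated on the contour by a convergent series of constants is integrated
term by term. -/
lemma HasContourMean.of_hasSum (hγ : IsContourAroundZero r γ) {F : ℕ → ℂ → ℂ} {f : ℂ → ℂ}
    {c : ℕ → ℂ} {b : ℕ → ℝ} (hF : ∀ n, HasContourMean γ (F n) (c n)) (hb : Summable b)
    (hFb : ∀ n s, ‖F n (γ s)‖ ≤ b n) (hf : ∀ s, HasSum (fun n => F n (γ s)) (f (γ s))) :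
    ContinuousOn f (Set.range γ) ∧ HasSum c (curveIntegral (logForm f) γ) := by
  have hext : ∀ s : ℝ, ∃ s', γ.extend s = γ s' := fun s => by
    obtain ⟨s', hs'⟩ := extend_mem_range γ s
    exact ⟨s', hs'.symm⟩
  constructor
  · refine (continuousOn_tsum (fun n => (hF n).1) hb ?_).congr ?_
    · rintro n _ ⟨s, rfl⟩
      exact hFb n s
    · rintro _ ⟨s, rfl⟩
      exact (hf s).tsum_eq.symm
  · obtain rfl : c = fun n => ∫ s in (0 : ℝ)..1,
        F n (γ.extend s) * curveIntegralFun (logForm fun _ => 1) γ s := by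
      funext n
      rw [← (hF n).2, curveIntegral_logForm]
    rw [curveIntegral_logForm]
    have hℓ := hγ.intervalIntegrable
    refine intervalIntegral.hasSum_integral_of_dominated_convergence
      (fun n s => b n * ‖curveIntegralFun (logForm fun _ => 1) γ s‖) (fun n => ?_) (fun n => ?_)
      ?_ ?_ ?_
    · exact ((hℓ.continuousOn_mul
        (continuous_comp_extend (hF n).1).continuousOn).def').aestronglyMeasurable
    · refine Filter.Eventually.of_forall fun s _ => ?_
      obtain ⟨s', hs'⟩ := hext s
      rw [norm_mul, hs']
      exact mul_le_mul_of_nonneg_right (hFb n s') (norm_nonneg _)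
    · exact Filter.Eventually.of_forall fun s _ => hb.mul_right _
    · simp only [tsum_mul_right]
      exact hℓ.norm.const_mul _
    · refine Filter.Eventually.of_forall fun s _ => ?_
      obtain ⟨s', hs'⟩ := hext s
      rw [hs']
      exact (hf s').mul_right _

/-- A point of `(0, 1)` that is not a subdivision point lies inside one of the intervals of the
subdivision. -/
lemma exists_mem_Ioo_of_subdivision {n : ℕ} {τ : Fin (n + 1) → ℝ} (h0 : τ 0 = 0)
    (h1 : τ (Fin.last n) = 1) {x : ℝ} (hx : x ∈ Set.Ioo (0 : ℝ) 1) (hxτ : x ∉ Set.range τ) :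
    ∃ i : Fin n, x ∈ Set.Ioo (τ i.castSucc) (τ i.succ) := by
  by_contra! h
  have : ∀ i : Fin (n + 1), τ i < x := by
    intro i
    induction i using Fin.induction with
    | zero => rw [h0]; exact hx.1
    | succ i ih =>
      rcases lt_trichotomy (τ i.succ) x with h' | h' | h'
      · exact h'
      · exact absurd ⟨_, h'⟩ hxτ
      · exact absurd ⟨ih, h'⟩ (h i)
  have := this (Fin.last n)
  rw [h1] at this
  exact absurd hx.2 this.le.not_gt

lemma IsContourAroundZero.ne_zero (hγ : IsContourAroundZero r γ) (s : unitInterval) :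
    γ s ≠ 0 := norm_pos_iff.1 (hγ.mem s).1

lemma IsContourAroundZero.extend_ne_zero (hγ : IsContourAroundZero r γ) (s : ℝ) :
    γ.extend s ≠ 0 := by
  obtain ⟨s', hs'⟩ := extend_mem_range γ s
  rw [← hs']
  exact hγ.ne_zero s'

lemma IsContourAroundZero.continuousOn_zpow (hγ : IsContourAroundZero r γ) (m : ℤ) :
    ContinuousOn (fun z : ℂ => z ^ m) (Set.range γ) := by
  rintro _ ⟨s, rfl⟩
  exact (continuousAt_zpow₀ _ _ (Or.inl (hγ.ne_zero s))).continuousWithinAt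

/-- The mean of a nontrivial power vanishes, since `z ^ m / z` has a primitive. -/
lemma hasContourMean_zpow (hγ : IsContourAroundZero r γ) {m : ℤ} (hm : m ≠ 0) :
    HasContourMean γ (fun z => z ^ m) 0 := by
  refine ⟨hγ.continuousOn_zpow m, ?_⟩
  obtain ⟨n, τ, -, h0, h1, hτ⟩ := hγ.piecewise_C1
  have hcont : ContinuousOn (fun s : ℝ => γ.extend s ^ m) (Set.uIcc 0 1) :=
    (continuous_comp_extend (hγ.continuousOn_zpow m)).continuousOn
  have hderiv : ∀ x ∈ Set.Ioo (min (0 : ℝ) 1) (max 0 1) \ Set.range τ,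
      HasDerivAt (fun s : ℝ => γ.extend s ^ m)
        ((2 * Real.pi * Complex.I * m) * (γ.extend x ^ m *
          curveIntegralFun (logForm fun _ => 1) γ x)) x := by
    rintro x ⟨hx, hxτ⟩
    rw [min_eq_left zero_le_one, max_eq_right zero_le_one] at hx
    obtain ⟨i, hi⟩ := exists_mem_Ioo_of_subdivision h0 h1 hx hxτ
    have hd : DifferentiableAt ℝ γ.extend x :=
      ((hτ i).differentiableOn one_ne_zero).differentiableAt (Icc_mem_nhds hi.1 hi.2)
    have hdw : derivWithin γ.extend (Set.Icc 0 1) x = deriv γ.extend x :=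
      derivWithin_of_mem_nhds (Icc_mem_nhds hx.1 hx.2)
    have hne := hγ.extend_ne_zero x
    have h2 := (hasDerivAt_zpow m (γ.extend x) (Or.inl hne)).comp x hd.hasDerivAt
    refine h2.congr_deriv ?_
    rw [curveIntegralFun_def]
    simp only [logForm, smul_apply, ContinuousLinearMap.id_apply, smul_eq_mul]
    rw [zpow_sub_one₀ hne]
    have hpi : (Real.pi : ℂ) ≠ 0 := by exact_mod_cast Real.pi_ne_zero
    have : derivWithin γ.extend unitInterval x = deriv γ.extend x := hdw
    rw [this]
    field_simp [Complex.I_ne_zero]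
  have hint : IntervalIntegrable (fun s => (2 * Real.pi * Complex.I * m) * (γ.extend s ^ m *
      curveIntegralFun (logForm fun _ => 1) γ s)) volume 0 1 :=
    (hγ.intervalIntegrable.continuousOn_mul
      (continuous_comp_extend (hγ.continuousOn_zpow m)).continuousOn).const_mul _
  have := MeasureTheory.integral_eq_of_hasDerivAt_off_countable _ _
    (Set.countable_range τ) hcont hderiv hint
  rw [intervalIntegral.integral_const_mul, ← curveIntegral_logForm (fun z => z ^ m)] at this
  simp only [Path.extend_one, Path.extend_zero, sub_self, mul_eq_zero] at this
  refine this.resolve_left ?_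
  simp [hm, Real.pi_ne_zero]

lemma hasContourMean_one (hγ : IsContourAroundZero r γ) : HasContourMean γ (fun _ => 1) 1 :=
  ⟨continuousOn_const, hγ.winding⟩

/-- The mean of a polynomial in a nontrivial power of `z` is its constant coefficient. -/
lemma hasContourMean_polynomial (hγ : IsContourAroundZero r γ) {m : ℤ} (hm : m ≠ 0)
    (P : Polynomial ℂ) : HasContourMean γ (fun z => P.eval (z ^ m)) (P.eval 0) := by
  have h : ∀ e ∈ Finset.range (P.natDegree + 1),
      HasContourMean γ (fun z => P.coeff e * z ^ (m * e)) (P.coeff e * 0 ^ e) := by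
    intro e _
    rcases eq_or_ne e 0 with rfl | he
    · simpa using (hasContourMean_one hγ).const_mul (P.coeff 0)
    · have := (hasContourMean_zpow hγ (m := m * e) (by simp [hm, he])).const_mul (P.coeff e)
      simpa [he] using this
  have := HasContourMean.sum hγ _ h
  rw [← Polynomial.eval_eq_sum_range] at this
  refine this.congr fun s => ?_
  rw [Polynomial.eval_eq_sum_range]
  simp only [zpow_mul, zpow_natCast]

end Contour

/-! ### Sums over the Bethe roots -/

section BetheSums

open Polynomial

variable {N L : ℕ}

lemma density_pos (hN : 1 ≤ N) (hNL : N < L) : 0 < density N L := by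
  unfold density
  have : (0 : ℝ) < L := by exact_mod_cast (by omega : 0 < L)
  positivity

lemma density_lt_one (hNL : N < L) : density N L < 1 := by
  unfold density
  have : (0 : ℝ) < L := by exact_mod_cast (by omega : 0 < L)
  rw [div_lt_one this]
  exact_mod_cast hNL

lemma mul_density (hNL : N < L) : (L : ℝ) * density N L = N := by
  unfold density
  have : (0 : ℝ) < L := by exact_mod_cast (by omega : 0 < L)
  field_simp

lemma criticalRadius_pos (hN : 1 ≤ N) (hNL : N < L) : 0 < criticalRadius N L := by
  have h1 := density_pos hN hNL
  have h2 := density_lt_one hNL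
  unfold criticalRadius
  have : 0 < 1 - density N L := by linarith
  positivity

lemma criticalRadius_pow (hN : 1 ≤ N) (hNL : N < L) :
    criticalRadius N L ^ L = density N L ^ N * (1 - density N L) ^ (L - N) := by
  have h1 := density_pos hN hNL
  have h2 : 0 < 1 - density N L := by linarith [density_lt_one hNL]
  have h3 := mul_density hNL
  unfold criticalRadius
  rw [mul_pow, ← Real.rpow_natCast, ← Real.rpow_natCast, ← Real.rpow_mul h1.le,
    ← Real.rpow_mul h2.le, sub_mul, mul_comm _ (L : ℝ), h3, Real.rpow_natCast, one_mul,
    ← Nat.cast_sub hNL.le, Real.rpow_natCast]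

lemma bethePoly_monic (hN : 1 ≤ N) (hNL : N < L) (z : ℂ) :
    (bethePoly N L z).Monic ∧ (bethePoly N L z).natDegree = L := by
  have hm1 : (X + 1 : ℂ[X]).Monic := monic_X_add_C 1
  have hm : (X ^ N * (X + 1) ^ (L - N) : ℂ[X]).Monic := (monic_X_pow N).mul (hm1.pow _)
  have hd : (X ^ N * (X + 1) ^ (L - N) : ℂ[X]).natDegree = L := by
    rw [(monic_X_pow N).natDegree_mul (hm1.pow _), natDegree_X_pow, hm1.natDegree_pow]
    rw [show (X + 1 : ℂ[X]).natDegree = 1 from natDegree_X_add_C 1]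
    omega
  have hlt : (C (z ^ L)).degree < (X ^ N * (X + 1) ^ (L - N) : ℂ[X]).degree := by
    refine lt_of_le_of_lt degree_C_le ?_
    rw [degree_eq_natDegree hm.ne_zero, hd]
    exact_mod_cast (by omega : 0 < L)
  refine ⟨hm.sub_of_left hlt, ?_⟩
  unfold bethePoly
  rw [natDegree_sub_eq_left_of_natDegree_lt, hd]
  rw [natDegree_C, hd]
  omega

/-- All roots of `q_z`. -/
noncomputable def betheRoots (N L : ℕ) (z : ℂ) : Finset ℂ := (bethePoly N L z).roots.toFinset

lemma mem_betheRoots (hN : 1 ≤ N) (hNL : N < L) {z w : ℂ} :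
    w ∈ betheRoots N L z ↔ w ^ N * (w + 1) ^ (L - N) = z ^ L := by
  rw [betheRoots, Multiset.mem_toFinset, mem_roots (bethePoly_monic hN hNL z).1.ne_zero]
  simp [bethePoly, sub_eq_zero]

variable {z w : ℂ}

lemma ne_zero_of_mem_betheRoots (hN : 1 ≤ N) (hNL : N < L) (hz : 0 < ‖z‖)
    (hw : w ∈ betheRoots N L z) : w ≠ 0 ∧ w + 1 ≠ 0 := by
  rw [mem_betheRoots hN hNL] at hw
  have hz' : z ^ L ≠ 0 := pow_ne_zero _ (norm_pos_iff.1 hz)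
  rw [← hw] at hz'
  constructor
  · rintro rfl
    simp [show N ≠ 0 by omega] at hz'
  · intro h
    simp [h, show L - N ≠ 0 by omega] at hz'

/-- The point `-ρ`, the critical point of `w ^ N (w + 1) ^ (L - N)` besides `0` and `-1`, is a root
of `q_z` only for `|z| = r_0`. -/
lemma add_density_ne_zero_of_mem_betheRoots (hN : 1 ≤ N) (hNL : N < L)
    (hzr : ‖z‖ < criticalRadius N L) (hw : w ∈ betheRoots N L z) :
    w + density N L ≠ 0 := by
  intro h
  rw [mem_betheRoots hN hNL] at hw
  have h1 : w = -(density N L : ℂ) := by linear_combination h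
  have h2 := congrArg norm hw
  have h3 : -(density N L : ℂ) + 1 = ((1 - density N L : ℝ) : ℂ) := by push_cast; ring
  rw [h1, h3, norm_mul, norm_pow, norm_pow, norm_pow, norm_neg, Complex.norm_real,
    Complex.norm_real, Real.norm_of_nonneg (density_pos hN hNL).le,
    Real.norm_of_nonneg (by linarith [density_lt_one hNL]), ← criticalRadius_pow hN hNL] at h2
  exact (pow_lt_pow_left₀ hzr (norm_nonneg z) (by omega)).ne' h2

/-- The weight `w (w + 1) / (L (w + ρ))`, which is `z ^ L / q_z'(w)` at the roots of `q_z`. -/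
noncomputable def betheWeight (N L : ℕ) (w : ℂ) : ℂ := w * (w + 1) / (L * (w + density N L))

lemma eval_derivative_bethePoly (hN : 1 ≤ N) (hNL : N < L) (z w : ℂ) :
    (derivative (bethePoly N L z)).eval w * (w * (w + 1)) =
      L * (w + density N L) * (w ^ N * (w + 1) ^ (L - N)) := by
  have h3 : (L : ℂ) * density N L = N := by exact_mod_cast mul_density hNL
  obtain ⟨n, rfl⟩ : ∃ n, N = n + 1 := ⟨N - 1, by omega⟩
  obtain ⟨k, rfl⟩ : ∃ k, L = n + 1 + (k + 1) := ⟨L - (n + 1) - 1, by omega⟩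
  rw [mul_add (((n + 1 + (k + 1) : ℕ)) : ℂ), h3]
  simp only [bethePoly, Nat.add_sub_cancel_left, derivative_sub, derivative_mul, derivative_add,
    derivative_C, eval_sub, eval_add, eval_mul, eval_pow, eval_X, eval_C, derivative_pow,
    derivative_X, derivative_one, eval_one, eval_zero, Nat.add_sub_cancel]
  push_cast
  ring

lemma betheWeight_eq (hN : 1 ≤ N) (hNL : N < L) (hz : 0 < ‖z‖)
    (hzr : ‖z‖ < criticalRadius N L) (hw : w ∈ betheRoots N L z) :
    (derivative (bethePoly N L z)).eval w ≠ 0 ∧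
      betheWeight N L w = z ^ L / (derivative (bethePoly N L z)).eval w := by
  have h1 := eval_derivative_bethePoly hN hNL z w
  rw [(mem_betheRoots hN hNL).1 hw] at h1
  obtain ⟨h2, h3⟩ := ne_zero_of_mem_betheRoots hN hNL hz hw
  have h4 := add_density_ne_zero_of_mem_betheRoots hN hNL hzr hw
  have hL : (L : ℂ) ≠ 0 := by exact_mod_cast (by omega : L ≠ 0)
  have hz' : z ^ L ≠ 0 := pow_ne_zero _ (norm_pos_iff.1 hz)
  have h5 : (derivative (bethePoly N L z)).eval w ≠ 0 := by
    intro h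
    rw [h, zero_mul] at h1
    exact mul_ne_zero (mul_ne_zero hL h4) hz' h1.symm
  refine ⟨h5, ?_⟩
  rw [betheWeight, div_eq_div_iff (mul_ne_zero hL h4) h5]
  linear_combination h1

/-- For `0 < |z| < r_0` the roots of `q_z` are simple. -/
lemma bethePoly_eq_nodal (hN : 1 ≤ N) (hNL : N < L) (hz : 0 < ‖z‖)
    (hzr : ‖z‖ < criticalRadius N L) :
    bethePoly N L z = Lagrange.nodal (betheRoots N L z) id ∧ (betheRoots N L z).card = L := by
  obtain ⟨hm, hd⟩ := bethePoly_monic hN hNL z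
  have hnd : (bethePoly N L z).roots.Nodup := by
    rw [Multiset.nodup_iff_count_le_one]
    intro w
    by_contra! h
    rw [count_roots, one_lt_rootMultiplicity_iff_isRoot hm.ne_zero] at h
    have hw : w ∈ betheRoots N L z := by
      rw [betheRoots, Multiset.mem_toFinset, mem_roots hm.ne_zero]
      exact h.1
    exact (betheWeight_eq hN hNL hz hzr hw).1 h.2
  have hcard : Multiset.card (bethePoly N L z).roots = L := by
    rw [IsAlgClosed.card_roots_eq_natDegree, hd]
  constructor
  · conv_lhs => rw [← prod_multiset_X_sub_C_of_monic_of_roots_card_eq hm (hcard.trans hd.symm)]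
    rw [Lagrange.nodal, Finset.prod, betheRoots, Multiset.toFinset_val, hnd.dedup]
    rfl
  · rw [betheRoots, Multiset.toFinset_card_of_nodup hnd, hcard]

/-- The weighted sum of a function over the Bethe roots. -/
noncomputable def betheSum (N L : ℕ) (z : ℂ) (G : ℂ → ℂ) : ℂ :=
  ∑ w ∈ betheRoots N L z, betheWeight N L w * G w

/-- Lagrange interpolation: the sum of a polynomial of degree less than `L` picks out the
coefficient of degree `L - 1`. -/
lemma betheSum_eq_coeff (hN : 1 ≤ N) (hNL : N < L) (hz : 0 < ‖z‖)
    (hzr : ‖z‖ < criticalRadius N L) {G : ℂ[X]} (hG : G.degree < L) :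
    betheSum N L z (fun w => G.eval w) = z ^ L * G.coeff (L - 1) := by
  obtain ⟨h1, h2⟩ := bethePoly_eq_nodal hN hNL hz hzr
  have h3 := Lagrange.coeff_eq_sum (s := betheRoots N L z) (v := id)
    (Set.injOn_id _) (P := G) (by rw [h2]; exact hG)
  rw [h2] at h3
  rw [h3, Finset.mul_sum, betheSum]
  refine Finset.sum_congr rfl fun w hw => ?_
  have h4 := (betheWeight_eq hN hNL hz hzr hw).2
  rw [h1] at h4
  have h5 := Lagrange.eval_nodal_derivative_eval_node_eq (s := betheRoots N L z) (v := id) hw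
  rw [id, Lagrange.eval_nodal] at h5
  rw [h4, h5]
  simp only [id]
  ring

/-- The sum of a polynomial `G` over the Bethe roots is a polynomial in `z ^ L` without constant
term, of degree at most `(deg G + 1) / L`. -/
lemma exists_betheSum_eq (hN : 1 ≤ N) (hNL : N < L) (G : ℂ[X]) :
    ∃ P : ℂ[X], P.coeff 0 = 0 ∧ L * P.natDegree ≤ G.natDegree + 1 ∧
      ∀ z : ℂ, 0 < ‖z‖ → ‖z‖ < criticalRadius N L →
        betheSum N L z (fun w => G.eval w) = P.eval (z ^ L) := by
  induction hD : G.natDegree using Nat.strong_induction_on generalizing G with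
  | _ D ih =>
    have hsmall : ∀ G : ℂ[X], G.degree < L → ∃ P : ℂ[X], P.coeff 0 = 0 ∧
        L * P.natDegree ≤ G.natDegree + 1 ∧ P.natDegree ≤ 1 ∧
        ∀ z : ℂ, 0 < ‖z‖ → ‖z‖ < criticalRadius N L →
          betheSum N L z (fun w => G.eval w) = P.eval (z ^ L) := by
      intro G hG
      refine ⟨C (G.coeff (L - 1)) * X, by simp, ?_,
        natDegree_C_mul_le _ _ |>.trans natDegree_X_le, fun z hz hzr => ?_⟩
      · rcases eq_or_ne (G.coeff (L - 1)) 0 with h | h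
        · simp [h]
        · have := le_natDegree_of_ne_zero h
          rw [natDegree_C_mul_X _ h]
          omega
      · rw [betheSum_eq_coeff hN hNL hz hzr hG]
        rw [eval_mul, eval_C, eval_X, mul_comm]
    rcases lt_or_ge G.natDegree L with h | h
    · obtain ⟨P, h1, h2, -, h3⟩ := hsmall G
        (lt_of_le_of_lt degree_le_natDegree (by exact_mod_cast h))
      exact ⟨P, h1, hD ▸ h2, h3⟩
    -- division by `w ^ N (w + 1) ^ (L - N)`, which takes the value `z ^ L` at every root
    · set Q : ℂ[X] := bethePoly N L 0 with hQ
      obtain ⟨hQm, hQd⟩ := bethePoly_monic hN hNL 0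
      have hdiv : (G /ₘ Q).natDegree = D - L := by
        rw [natDegree_divByMonic G hQm, hQd, hD]
      obtain ⟨P₁, h1, h2, h3⟩ := ih (D - L) (by omega) (G /ₘ Q) hdiv
      obtain ⟨P₂, h4, -, h5, h6⟩ := hsmall (G %ₘ Q) (by
        refine (degree_modByMonic_lt G hQm).trans_eq ?_
        rw [degree_eq_natDegree hQm.ne_zero, hQd])
      refine ⟨X * P₁ + P₂, by simp [h4], ?_, fun z hz hzr => ?_⟩
      · have h7 : (X * P₁ + P₂).natDegree ≤ max (1 + P₁.natDegree) 1 := by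
          refine (natDegree_add_le _ _).trans (max_le_max ?_ h5)
          exact natDegree_mul_le.trans (by simp)
        rw [max_eq_left (by omega)] at h7
        calc L * (X * P₁ + P₂).natDegree ≤ L * (1 + P₁.natDegree) := Nat.mul_le_mul_left _ h7
          _ = L + L * P₁.natDegree := by ring
          _ ≤ D + 1 := by omega
      · rw [eval_add, eval_mul, eval_X, ← h3 z hz hzr, ← h6 z hz hzr, betheSum, betheSum, betheSum,
          Finset.mul_sum, ← Finset.sum_add_distrib]
        refine Finset.sum_congr rfl fun w hw => ?_
        have h8 : Q.eval w = z ^ L := by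
          rw [← (mem_betheRoots hN hNL).1 hw]
          simp [hQ, bethePoly, show L ≠ 0 by omega]
        conv_lhs => rw [← modByMonic_add_div G Q]
        rw [eval_add, eval_mul, h8]
        ring

/-- The sum of `w ^ m * (w + 1) ^ n` over the Bethe roots. -/
noncomputable def betheMoment (N L : ℕ) (m n : ℤ) (z : ℂ) : ℂ :=
  betheSum N L z fun w => w ^ m * (w + 1) ^ n

/-- Multiplication by a power of `w ^ N (w + 1) ^ (L - N) = z ^ L` shifts both exponents. -/
lemma betheMoment_shift (hN : 1 ≤ N) (hNL : N < L) (hz : 0 < ‖z‖) (m n : ℤ) (p : ℕ) :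
    betheMoment N L (m + N * p) (n + (L - N : ℕ) * p) z = (z ^ L) ^ p * betheMoment N L m n z := by
  rw [betheMoment, betheMoment, betheSum, betheSum, Finset.mul_sum]
  refine Finset.sum_congr rfl fun w hw => ?_
  obtain ⟨h2, h3⟩ := ne_zero_of_mem_betheRoots hN hNL hz hw
  rw [← (mem_betheRoots hN hNL).1 hw, zpow_add₀ h2, zpow_add₀ h3, zpow_mul, zpow_mul, mul_pow]
  simp only [zpow_natCast]
  ring

lemma betheMoment_natCast (m n : ℕ) (z : ℂ) :
    betheMoment N L m n z =
      betheSum N L z (fun w => (X ^ m * (X + 1) ^ n : ℂ[X]).eval w) := by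
  simp [betheMoment]

lemma natDegree_X_pow_mul_X_add_one_pow (m n : ℕ) :
    (X ^ m * (X + 1) ^ n : ℂ[X]).natDegree = m + n ∧ (X ^ m * (X + 1) ^ n : ℂ[X]).Monic := by
  have hm1 : (X + 1 : ℂ[X]).Monic := monic_X_add_C 1
  refine ⟨?_, (monic_X_pow m).mul (hm1.pow _)⟩
  rw [(monic_X_pow m).natDegree_mul (hm1.pow _), natDegree_X_pow, hm1.natDegree_pow,
    show (X + 1 : ℂ[X]).natDegree = 1 from natDegree_X_add_C 1, mul_one]

lemma exists_betheMoment_of_nonneg (hN : 1 ≤ N) (hNL : N < L) {m n : ℤ} (hm : 0 ≤ m)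
    (hn : 0 ≤ n) :
    ∃ P : ℂ[X], P.eval 0 = 0 ∧ ∀ z : ℂ, 0 < ‖z‖ → ‖z‖ < criticalRadius N L →
      betheMoment N L m n z = P.eval (z ^ L) := by
  lift m to ℕ using hm
  lift n to ℕ using hn
  obtain ⟨P, h1, -, h3⟩ := exists_betheSum_eq hN hNL (X ^ m * (X + 1) ^ n : ℂ[X])
  refine ⟨P, by rw [← coeff_zero_eq_eval_zero, h1], fun z hz hzr => ?_⟩
  rw [betheMoment_natCast, h3 z hz hzr]

/-- Raising the exponents by `N` and `L - N` costs one factor `z ^ L`, which the missing constant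
term in the nonnegative case provides. -/
lemma exists_betheMoment_of_neg_le (hN : 1 ≤ N) (hNL : N < L) {m n : ℤ} (hm : -(N : ℤ) ≤ m)
    (hn : 0 ≤ n) :
    ∃ P : ℂ[X], ∀ z : ℂ, 0 < ‖z‖ → ‖z‖ < criticalRadius N L →
      betheMoment N L m n z = P.eval (z ^ L) := by
  obtain ⟨P, h1, h3⟩ := exists_betheMoment_of_nonneg hN hNL (m := m + N) (n := n + (L - N : ℕ))
    (by omega) (by omega)
  refine ⟨P.divX, fun z hz hzr => ?_⟩
  have h4 := h3 z hz hzr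
  have h5 := betheMoment_shift hN hNL hz m n 1
  have hz' : z ^ L ≠ 0 := pow_ne_zero _ (norm_pos_iff.1 hz)
  simp only [Nat.cast_one, mul_one, pow_one] at h5
  rw [h5, ← divX_mul_X_add P, coeff_zero_eq_eval_zero, h1] at h4
  simp only [map_zero, add_zero, eval_mul, eval_X] at h4
  exact mul_left_cancel₀ hz' (h4.trans (mul_comm _ _))

/-- The exponent `-1` of `w` is where the constant term `1` comes from: for `n = 0` the shifted moment
is `z ^ L` times the leading coefficient of a monic polynomial of degree `L - 1`. -/
lemma exists_betheMoment_neg_one (hN : 1 ≤ N) (hNL : N < L) {n : ℤ} (hn : 0 ≤ n) :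
    ∃ P : ℂ[X], P.eval 0 = 1 ∧ ∀ z : ℂ, 0 < ‖z‖ → ‖z‖ < criticalRadius N L →
      betheMoment N L (-1) n z = P.eval (z ^ L) := by
  lift n to ℕ using hn
  induction n with
  | zero =>
    refine ⟨1, by simp, fun z hz hzr => ?_⟩
    have hz' : z ^ L ≠ 0 := pow_ne_zero _ (norm_pos_iff.1 hz)
    have h5 := betheMoment_shift hN hNL hz (-1) 0 1
    obtain ⟨h6, h7⟩ := natDegree_X_pow_mul_X_add_one_pow (N - 1) (L - N)
    have h8 : (-1 : ℤ) + N * (1 : ℕ) = ((N - 1 : ℕ) : ℤ) := by omega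
    have h9 : (0 : ℤ) + (L - N : ℕ) * (1 : ℕ) = ((L - N : ℕ) : ℤ) := by omega
    rw [h8, h9, betheMoment_natCast, betheSum_eq_coeff hN hNL hz hzr] at h5
    · have h10 : (X ^ (N - 1) * (X + 1) ^ (L - N) : ℂ[X]).coeff (L - 1) = 1 := by
        have : L - 1 = (X ^ (N - 1) * (X + 1) ^ (L - N) : ℂ[X]).natDegree := by omega
        rw [this]
        exact h7
      rw [h10, pow_one] at h5
      simp only [Nat.cast_zero, eval_one]
      exact (mul_left_cancel₀ hz' h5).symm
    · rw [degree_eq_natDegree h7.ne_zero, h6]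
      exact_mod_cast (by omega : N - 1 + (L - N) < L)
  | succ n ih =>
    obtain ⟨P, h1, h2⟩ := ih
    obtain ⟨P', h3, h4⟩ := exists_betheMoment_of_nonneg hN hNL (m := 0) (n := n) le_rfl
      (by positivity)
    refine ⟨P + P', by simp [h1, h3], fun z hz hzr => ?_⟩
    rw [eval_add, ← h2 z hz hzr, ← h4 z hz hzr]
    simp only [betheMoment, betheSum, ← Finset.sum_add_distrib]
    refine Finset.sum_congr rfl fun w hw => ?_
    obtain ⟨h5, h6⟩ := ne_zero_of_mem_betheRoots hN hNL hz hw
    push_cast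
    rw [zpow_add_one₀ h6, zpow_neg_one, zpow_zero]
    field_simp
    ring

/-- When the total degree is small, the moment is a polynomial in `z ^ (-L)`: shift both exponents
until they are nonnegative and reverse the polynomial in `z ^ L` obtained there, whose degree is
bounded by the total degree. -/
lemma exists_betheMoment_of_le (hN : 1 ≤ N) (hNL : N < L) {m n : ℤ} (hmn : m + n ≤ L - 2) :
    ∃ P : ℂ[X], (m + n ≤ -2 → P.eval 0 = 0) ∧
      ∀ z : ℂ, 0 < ‖z‖ → ‖z‖ < criticalRadius N L →
        betheMoment N L m n z = P.eval ((z ^ L)⁻¹) := by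
  set p : ℕ := m.natAbs + n.natAbs with hp
  have hpN : (p : ℤ) ≤ N * p := by
    have : 1 * p ≤ N * p := Nat.mul_le_mul_right p hN
    omega
  have hpM : (p : ℤ) ≤ (L - N : ℕ) * p := by
    have : 1 * p ≤ (L - N) * p := Nat.mul_le_mul_right p (by omega)
    omega
  obtain ⟨m', hm'⟩ : ∃ m' : ℕ, m + N * p = m' := ⟨(m + N * p).toNat, by omega⟩
  obtain ⟨n', hn'⟩ : ∃ n' : ℕ, n + (L - N : ℕ) * p = n' :=
    ⟨(n + (L - N : ℕ) * p).toNat, by omega⟩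
  obtain ⟨P, h1, h2, h3⟩ := exists_betheSum_eq hN hNL (X ^ m' * (X + 1) ^ n' : ℂ[X])
  rw [(natDegree_X_pow_mul_X_add_one_pow m' n').1] at h2
  have hsum : (m' + n' : ℤ) = m + n + L * p := by
    rw [← hm', ← hn', Nat.cast_sub hNL.le]
    ring
  have hdeg : P.natDegree ≤ p := by
    by_contra! h
    have : L * (p + 1) ≤ L * P.natDegree := Nat.mul_le_mul_left L h
    have h' : (L : ℤ) * (p + 1) ≤ L * P.natDegree := by exact_mod_cast this
    have h2' : (L : ℤ) * P.natDegree ≤ m' + n' + 1 := by exact_mod_cast h2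
    nlinarith
  refine ⟨P.reflect p, fun h => ?_, fun z hz hzr => ?_⟩
  · rw [← coeff_zero_eq_eval_zero, coeff_reflect, revAt_le (Nat.zero_le p), Nat.sub_zero]
    refine coeff_eq_zero_of_natDegree_lt ?_
    by_contra! h'
    have : L * p ≤ L * P.natDegree := Nat.mul_le_mul_left L h'
    have h' : (L : ℤ) * p ≤ L * P.natDegree := by exact_mod_cast this
    have h2' : (L : ℤ) * P.natDegree ≤ m' + n' + 1 := by exact_mod_cast h2
    linarith
  · have hz' : z ^ L ≠ 0 := pow_ne_zero _ (norm_pos_iff.1 hz)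
    have h4 := betheMoment_shift hN hNL hz m n p
    rw [hm', hn', betheMoment_natCast, h3 z hz hzr] at h4
    let := invertibleOfNonzero hz'
    have h5 := eval₂_reflect_mul_pow (RingHom.id ℂ) (z ^ L) p P hdeg
    rw [invOf_eq_inv] at h5
    simp only [← Polynomial.eval₂_id] at h4 ⊢
    rw [← h5] at h4
    have h6 := pow_ne_zero p hz'
    refine mul_left_cancel₀ h6 ?_
    rw [← h4]
    ring

/-- The mean of the determinantal expression for the probability that the first particle, started
at `y 0`, has reached `a` at time `0`. If `a ≤ y 0`, the matrix is polynomial in `z ^ L`, and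
unitriangular for `z = 0`; otherwise it is polynomial in `z ^ (-L)` and its first column vanishes
for `z = ∞`. -/
lemma hasContourMean_det_betheMoment {n : ℕ} (hNL : n + 1 < L) {p : ℂ} {γ : Path p p}
    (hγ : IsContourAroundZero (criticalRadius (n + 1) L) γ) (a : ℤ)
    (y : Config (n + 1) L) :
    HasContourMean γ (fun z => (Matrix.of fun i j : Fin (n + 1) =>
      betheMoment (n + 1) L ((j : ℤ) - i - 1) (y.1 j - j - a) z).det)
      (if a ≤ y.1 0 then 1 else 0) := by
  obtain ⟨hmono, hper⟩ := y.2
  have hN : 1 ≤ n + 1 := by omega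
  have hL0 : (L : ℤ) ≠ 0 := by omega
  have hdet : ∀ (P : Fin (n + 1) → Fin (n + 1) → ℂ[X]) (x : ℂ),
      (Matrix.of fun i j => (P i j).eval x).det = (Matrix.of P).det.eval x := by
    intro P x
    rw [← coe_evalRingHom, RingHom.map_det]
    rfl
  have hgap : ∀ j : Fin (n + 1), (j : ℤ) ≤ y.1 j - y.1 0 := by
    intro j
    induction j using Fin.induction with
    | zero => simp
    | succ j ih =>
      have := hmono (Fin.castSucc_lt_succ (i := j))
      simp only [Fin.val_castSucc, Fin.val_succ] at *
      push_cast
      omega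
  have hgap' : ∀ j : Fin (n + 1), y.1 j - j ≤ y.1 (Fin.last n) - n := by
    intro j
    induction j using Fin.reverseInduction with
    | last => simp
    | cast j ih =>
      have := hmono (Fin.castSucc_lt_succ (i := j))
      simp only [Fin.val_castSucc, Fin.val_succ] at *
      push_cast at *
      omega
  have hlast := hper 0 (Fin.last n)
  split_ifs with ha
  · have hex : ∀ i j : Fin (n + 1), ∃ P : ℂ[X], (i < j → P.eval 0 = 0) ∧ (i = j → P.eval 0 = 1) ∧
        ∀ z : ℂ, 0 < ‖z‖ → ‖z‖ < criticalRadius (n + 1) L →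
          betheMoment (n + 1) L ((j : ℤ) - i - 1) (y.1 j - j - a) z = P.eval (z ^ L) := by
      intro i j
      have hexp : 0 ≤ y.1 j - j - a := by linarith [hgap j]
      rcases lt_trichotomy i j with hij | rfl | hij
      · obtain ⟨P, h1, h2⟩ := exists_betheMoment_of_nonneg hN hNL (m := (j : ℤ) - i - 1)
          (by have : (i : ℕ) < j := hij
              omega) hexp
        exact ⟨P, fun _ => h1, fun h => absurd h hij.ne, h2⟩
      · obtain ⟨P, h1, h2⟩ := exists_betheMoment_neg_one hN hNL hexp
        refine ⟨P, fun h => absurd h (lt_irrefl _), fun _ => h1, ?_⟩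
        simpa using h2
      · obtain ⟨P, h2⟩ := exists_betheMoment_of_neg_le hN hNL (m := (j : ℤ) - i - 1)
          (by have := i.2
              omega) hexp
        exact ⟨P, fun h => absurd h hij.not_gt, fun h => absurd h hij.ne', h2⟩
    choose P h1 h2 h3 using hex
    have h4 : (Matrix.of P).det.eval 0 = 1 := by
      rw [← hdet, Matrix.det_of_isLowerTriangular]
      · simp [h2]
      · intro i j hij
        exact h1 i j hij
    have h5 := hasContourMean_polynomial hγ hL0 (Matrix.of P).det
    rw [h4] at h5
    refine h5.congr fun s => ?_
    rw [← hdet, zpow_natCast]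
    congr 2
    funext i j
    exact h3 i j _ (hγ.mem s).1 (hγ.mem s).2
  · have hex : ∀ i j : Fin (n + 1), ∃ P : ℂ[X], (j = 0 → P.eval 0 = 0) ∧
        ∀ z : ℂ, 0 < ‖z‖ → ‖z‖ < criticalRadius (n + 1) L →
          betheMoment (n + 1) L ((j : ℤ) - i - 1) (y.1 j - j - a) z = P.eval ((z ^ L)⁻¹) := by
      intro i j
      obtain ⟨P, h1, h2⟩ := exists_betheMoment_of_le hN hNL (m := (j : ℤ) - i - 1)
          (n := y.1 j - j - a) (by
            have := hgap' j
            have := j.2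
            omega)
      refine ⟨P, ?_, h2⟩
      rintro rfl
      refine h1 ?_
      simp only [Fin.val_zero, Nat.cast_zero]
      omega
    choose P h1 h3 using hex
    have h4 : (Matrix.of P).det.eval 0 = 0 := by
      rw [← hdet]
      exact Matrix.det_eq_zero_of_column_eq_zero 0 fun i => h1 i 0 rfl
    have h5 := hasContourMean_polynomial hγ (neg_ne_zero.2 hL0) (Matrix.of P).det
    rw [h4] at h5
    refine h5.congr fun s => ?_
    rw [← hdet, zpow_neg, zpow_natCast]
    congr 2
    funext i j
    exact h3 i j _ (hγ.mem s).1 (hγ.mem s).2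

end BetheSums

/-! ### The Bethe ansatz for the backward equation -/

section Evolution

variable {n L : ℕ}

/-- The summand of the Bethe ansatz, for the initial position `y`, which belongs to the
choice `W` of one Bethe root for every particle. -/
noncomputable def waveTerm (L : ℕ) (a : ℤ) (W : Fin (n + 1) → ℂ) (y : Fin (n + 1) → ℤ) : ℂ :=
  (Matrix.of fun i j : Fin (n + 1) => W j ^ (-(i : ℤ))).det *
    ∏ j, betheWeight (n + 1) L (W j) * W j ^ ((j : ℤ) - 1) * (W j + 1) ^ (y j - j - a)

/-- All choices of one root of `q_z` for every particle. -/
noncomputable def rootChoices (n L : ℕ) (z : ℂ) : Finset (Fin (n + 1) → ℂ) :=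
  Fintype.piFinset fun _ => betheRoots (n + 1) L z

/-- The `m`-th time derivative at time `0` of the Bethe ansatz solution of the backward equation. -/
noncomputable def waveCoeff (L : ℕ) (a : ℤ) (m : ℕ) (y : Fin (n + 1) → ℤ) (z : ℂ) : ℂ :=
  ∑ W ∈ rootChoices n L z, (∑ j, W j) ^ m * waveTerm L a W y

/-- Multilinearity of the determinant in its columns. -/
lemma det_betheSum (hNL : n + 1 < L) {z : ℂ} (hz : 0 < ‖z‖) (a : ℤ) (y : Fin (n + 1) → ℤ)
    (φ : ℂ → ℂ) :
    (Matrix.of fun i j : Fin (n + 1) => betheSum (n + 1) L z fun w =>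
      φ w * (w ^ ((j : ℤ) - i - 1) * (w + 1) ^ (y j - j - a))).det =
    ∑ W ∈ rootChoices n L z, (∏ j, φ (W j)) * waveTerm L a W y := by
  rw [← Matrix.det_transpose]
  have hrow : (Matrix.of fun i j : Fin (n + 1) => betheSum (n + 1) L z fun w =>
      φ w * (w ^ ((j : ℤ) - i - 1) * (w + 1) ^ (y j - j - a))).transpose =
      fun j : Fin (n + 1) => ∑ w ∈ betheRoots (n + 1) L z,
        (φ w * (betheWeight (n + 1) L w * w ^ ((j : ℤ) - 1) * (w + 1) ^ (y j - j - a))) •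
          fun i : Fin (n + 1) => w ^ (-(i : ℤ)) := by
    funext j i
    simp only [Matrix.transpose_apply, Matrix.of_apply, betheSum, Finset.sum_apply, Pi.smul_apply,
      smul_eq_mul]
    refine Finset.sum_congr rfl fun w hw => ?_
    obtain ⟨h2, -⟩ := ne_zero_of_mem_betheRoots (by omega) hNL hz hw
    rw [show (j : ℤ) - i - 1 = (j - 1) + -i by ring, zpow_add₀ h2]
    ring
  have h1 := (Matrix.detRowAlternating (R := ℂ) (n := Fin (n + 1))).toMultilinearMap.map_sum_finset
    (fun (j : Fin (n + 1)) (w : ℂ) => (φ w * (betheWeight (n + 1) L w * w ^ ((j : ℤ) - 1) *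
        (w + 1) ^ (y j - j - a))) • fun i : Fin (n + 1) => w ^ (-(i : ℤ)))
    (fun _ => betheRoots (n + 1) L z)
  rw [hrow]
  refine h1.trans (Finset.sum_congr rfl fun W _ => ?_)
  rw [MultilinearMap.map_smul_univ, Finset.prod_mul_distrib, waveTerm, smul_eq_mul,
    ← Matrix.det_transpose (Matrix.of _)]
  change _ * (Matrix.det (Matrix.of fun j i : Fin (n + 1) => W j ^ (-(i : ℤ)))) = _
  have : (Matrix.of fun i j : Fin (n + 1) => W j ^ (-(i : ℤ))).transpose =
    Matrix.of fun j i : Fin (n + 1) => W j ^ (-(i : ℤ)) := rfl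
  rw [this]
  ring

lemma waveCoeff_zero (hNL : n + 1 < L) {z : ℂ} (hz : 0 < ‖z‖) (a : ℤ) (y : Fin (n + 1) → ℤ) :
    waveCoeff L a 0 y z = (Matrix.of fun i j : Fin (n + 1) =>
      betheMoment (n + 1) L ((j : ℤ) - i - 1) (y j - j - a) z).det := by
  have := det_betheSum hNL hz a y (fun _ => 1)
  simp only [one_mul, Finset.prod_const_one] at this
  simp only [waveCoeff, pow_zero, one_mul, ← this]
  rfl

lemma mem_rootChoices {z : ℂ} {W : Fin (n + 1) → ℂ} :
    W ∈ rootChoices n L z ↔ ∀ j, W j ∈ betheRoots (n + 1) L z := by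
  simp [rootChoices]

lemma waveTerm_update (hNL : n + 1 < L) {z : ℂ} (hz : 0 < ‖z‖) (a : ℤ) (y : Fin (n + 1) → ℤ)
    {W : Fin (n + 1) → ℂ} (hW : W ∈ rootChoices n L z) (i : Fin (n + 1)) :
    waveTerm L a W (Function.update y i (y i + 1)) = (W i + 1) * waveTerm L a W y := by
  have h1 := (ne_zero_of_mem_betheRoots (by omega) hNL hz (mem_rootChoices.1 hW i)).2
  unfold waveTerm
  rw [← Finset.mul_prod_erase _ _ (Finset.mem_univ i),
    ← Finset.mul_prod_erase _ _ (Finset.mem_univ i), Function.update_self,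
    show y i + 1 - i - a = (y i - i - a) + 1 by ring, zpow_add_one₀ h1]
  have : ∀ j ∈ Finset.univ.erase i, betheWeight (n + 1) L (W j) * W j ^ ((j : ℤ) - 1) *
      (W j + 1) ^ (Function.update y i (y i + 1) j - j - a) =
      betheWeight (n + 1) L (W j) * W j ^ ((j : ℤ) - 1) * (W j + 1) ^ (y j - j - a) := by
    intro j hj
    rw [Function.update_of_ne (Finset.ne_of_mem_erase hj)]
  rw [Finset.prod_congr rfl this]
  ring

/-- The function of the root chosen by particle `j` in `waveTerm`, with an additional factor for
particle `i`. -/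
noncomputable def waveFactor (L : ℕ) (a : ℤ) (y : Fin (n + 1) → ℤ) (i j : Fin (n + 1)) (w : ℂ) :
    ℂ :=
  (if j = i then w else 1) *
    (betheWeight (n + 1) L w * w ^ ((j : ℤ) - 1) * (w + 1) ^ (y j - j - a))

lemma mul_waveTerm_eq (a : ℤ) (y : Fin (n + 1) → ℤ) (W : Fin (n + 1) → ℂ) (i : Fin (n + 1)) :
    W i * waveTerm L a W y = (Matrix.of fun i j : Fin (n + 1) => W j ^ (-(i : ℤ))).det *
      ∏ j, waveFactor L a y i j (W j) := by
  simp only [waveFactor, Finset.prod_mul_distrib (f := fun j => if j = i then W j else 1)]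
  rw [Finset.prod_ite_eq' Finset.univ i W, if_pos (Finset.mem_univ i), waveTerm]
  ring

/-- If the factors of two particles are proportional, then the exchange of their roots changes the
sign of the summand. -/
lemma sum_mul_waveTerm_eq_zero {z : ℂ} (a : ℤ) (y : Fin (n + 1) → ℤ) (m : ℕ)
    {i i' : Fin (n + 1)} (hii' : i ≠ i') {κ : ℂ}
    (hκ : ∀ w ∈ betheRoots (n + 1) L z, waveFactor L a y i i w = κ * waveFactor L a y i i' w) :
    ∑ W ∈ rootChoices n L z, (∑ j, W j) ^ m * (W i * waveTerm L a W y) = 0 := by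
  set e : Equiv.Perm (Fin (n + 1)) := Equiv.swap i i' with he
  have hmem : ∀ W ∈ rootChoices n L z, W ∘ e ∈ rootChoices n L z := fun W hW =>
    mem_rootChoices.2 fun j => mem_rootChoices.1 hW (e j)
  have hee : ∀ W : Fin (n + 1) → ℂ, (W ∘ e) ∘ e = W := by
    intro W
    funext j
    simp [he]
  have hanti : ∀ W ∈ rootChoices n L z,
      (∑ j, (W ∘ e) j) ^ m * ((W ∘ e) i * waveTerm L a (W ∘ e) y) =
      -((∑ j, W j) ^ m * (W i * waveTerm L a W y)) := by
    intro W hW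
    have h1 : ∑ j, (W ∘ e) j = ∑ j, W j := Equiv.sum_comp e W
    have h2 : (Matrix.of fun i j : Fin (n + 1) => (W ∘ e) j ^ (-(i : ℤ))).det =
        -(Matrix.of fun i j : Fin (n + 1) => W j ^ (-(i : ℤ))).det := by
      have := Matrix.det_permute' e (Matrix.of fun i j : Fin (n + 1) => W j ^ (-(i : ℤ)))
      rw [he, Equiv.Perm.sign_swap hii'] at this
      rw [Units.val_neg, Units.val_one, Int.cast_neg, Int.cast_one, neg_one_mul] at this
      exact this
    have h3 : ∏ j, waveFactor L a y i j ((W ∘ e) j) = ∏ j, waveFactor L a y i j (W j) := by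
      have hi' : i' ∈ Finset.univ.erase i := Finset.mem_erase.2 ⟨hii'.symm, Finset.mem_univ _⟩
      have hrest : ∀ j ∈ (Finset.univ.erase i).erase i',
          waveFactor L a y i j ((W ∘ e) j) = waveFactor L a y i j (W j) := by
        intro j hj
        have hj1 := Finset.ne_of_mem_erase hj
        have hj2 := Finset.ne_of_mem_erase (Finset.mem_of_mem_erase hj)
        rw [Function.comp_apply, he, Equiv.swap_apply_of_ne_of_ne hj2 hj1]
      rw [← Finset.mul_prod_erase _ _ (Finset.mem_univ i), ← Finset.mul_prod_erase _ _ hi',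
        ← Finset.mul_prod_erase _ (fun j => waveFactor L a y i j (W j)) (Finset.mem_univ i),
        ← Finset.mul_prod_erase _ (fun j => waveFactor L a y i j (W j)) hi',
        Finset.prod_congr rfl hrest]
      have h4 : (W ∘ e) i = W i' := by simp [he]
      have h5 : (W ∘ e) i' = W i := by simp [he]
      rw [h4, h5, hκ _ (mem_rootChoices.1 hW i'), hκ _ (mem_rootChoices.1 hW i)]
      ring
    rw [mul_waveTerm_eq, mul_waveTerm_eq, h1, h2, h3]
    ring
  have hsum : ∑ W ∈ rootChoices n L z, (∑ j, W j) ^ m * (W i * waveTerm L a W y) =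
      ∑ W ∈ rootChoices n L z, -((∑ j, W j) ^ m * (W i * waveTerm L a W y)) := by
    refine Finset.sum_nbij' (fun W => W ∘ e) (fun W => W ∘ e) hmem hmem (fun W _ => hee W)
      (fun W _ => hee W) fun W hW => ?_
    rw [hanti W hW, neg_neg]
  rw [Finset.sum_neg_distrib] at hsum
  exact self_eq_neg.1 hsum

/-- A jump is suppressed only if the site in front is occupied by the next particle, or, for the last
particle, by the periodic copy of the first one. -/
lemma eq_add_one_of_update_notMem (hNL : n + 1 < L) {y : Fin (n + 1) → ℤ}
    (hy : y ∈ Config (n + 1) L) {i : Fin (n + 1)}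
    (h : Function.update y i (y i + 1) ∉ Config (n + 1) L) :
    (∃ j : Fin n, i = j.castSucc ∧ y j.succ = y i + 1) ∨
      (i = Fin.last n ∧ i ≠ 0 ∧ y 0 + L = y i + 1) := by
  by_contra! hcon
  obtain ⟨h1, h2⟩ := hcon
  rw [mem_config_iff (by omega)] at hy h
  refine h fun j j' hjj' => ?_
  obtain ⟨h3, h4⟩ := hy j j' hjj'
  rcases eq_or_ne j i with rfl | hj
  · rw [Function.update_self, Function.update_of_ne hjj'.ne']
    obtain ⟨k, rfl⟩ := Fin.exists_castSucc_eq.2 (Fin.ne_last_of_lt hjj')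
    have h5 := h1 k rfl
    have h6 := (hy k.castSucc k.succ Fin.castSucc_lt_succ).1
    have h7 : y k.succ ≤ y j' := by
      rcases (Fin.castSucc_lt_iff_succ_le.1 hjj').eq_or_lt with h | h
      · rw [h]
      · exact (hy _ _ h).1.le
    omega
  · rw [Function.update_of_ne hj]
    rcases eq_or_ne j' i with rfl | hj'
    · rw [Function.update_self]
      refine ⟨by omega, ?_⟩
      have h0 : y 0 ≤ y j := by
        rcases (Fin.zero_le j).eq_or_lt with h | h
        · rw [h]
        · exact (hy _ _ h).1.le
      have hj0 : j' ≠ 0 := Fin.ne_zero_of_lt hjj'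
      rcases eq_or_ne j' (Fin.last n) with rfl | hl
      · have := h2 rfl hj0
        have := (hy 0 (Fin.last n) (Fin.pos_of_ne_zero hj0)).2
        omega
      · have h8 := hy j' (Fin.last n) (Fin.lt_last_iff_ne_last.2 hl)
        have h9 := (hy 0 (Fin.last n) ((Fin.pos_of_ne_zero hj0).trans
          (Fin.lt_last_iff_ne_last.2 hl))).2
        omega
    · rw [Function.update_of_ne hj']
      exact ⟨h3, h4⟩

open Classical in
/-- The Bethe ansatz solves the backward equation. A jump of particle `i` multiplies a summand by
`W i + 1`, so an allowed jump contributes the sum of the summands times `W i`. For a suppressed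
jump this sum has to vanish, by the antisymmetry in two roots; for the last particle this is where
the Bethe equation `w ^ N (w + 1) ^ (L - N) = z ^ L` enters. -/
lemma waveCoeff_succ (hNL : n + 1 < L) {z : ℂ} (hz : 0 < ‖z‖) (a : ℤ) (m : ℕ)
    {y : Fin (n + 1) → ℤ} (hy : y ∈ Config (n + 1) L) :
    waveCoeff L a (m + 1) y z = ∑ i, if Function.update y i (y i + 1) ∈ Config (n + 1) L then
      waveCoeff L a m (Function.update y i (y i + 1)) z - waveCoeff L a m y z else 0 := by
  have h1 : waveCoeff L a (m + 1) y z =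
      ∑ i, ∑ W ∈ rootChoices n L z, (∑ j, W j) ^ m * (W i * waveTerm L a W y) := by
    rw [Finset.sum_comm, waveCoeff]
    refine Finset.sum_congr rfl fun W _ => ?_
    rw [← Finset.mul_sum, ← Finset.sum_mul, pow_succ, mul_assoc]
  rw [h1]
  refine Finset.sum_congr rfl fun i _ => ?_
  split_ifs with h
  · rw [waveCoeff, waveCoeff, ← Finset.sum_sub_distrib]
    refine Finset.sum_congr rfl fun W hW => ?_
    rw [waveTerm_update hNL hz a y hW]
    ring
  · rcases eq_add_one_of_update_notMem hNL hy h with ⟨j, rfl, hj⟩ | ⟨rfl, h0, hj⟩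
    · refine sum_mul_waveTerm_eq_zero a y m (i' := j.succ) Fin.castSucc_lt_succ.ne (κ := 1)
        fun w hw => ?_
      obtain ⟨h2, h3⟩ := ne_zero_of_mem_betheRoots (by omega) hNL hz hw
      have h4 : ((j.succ : Fin (n + 1)) : ℤ) - 1 = ((j.castSucc : Fin (n + 1)) : ℤ) - 1 + 1 := by
        simp
      have h5 : y j.succ - ((j.succ : Fin (n + 1)) : ℤ) - a =
          y j.castSucc - ((j.castSucc : Fin (n + 1)) : ℤ) - a := by
        rw [hj]
        simp
      rw [waveFactor, waveFactor, if_pos rfl, if_neg Fin.castSucc_lt_succ.ne', h4, h5,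
        zpow_add_one₀ h2]
      ring
    -- the exponents differ by those of `w ^ N (w + 1) ^ (L - N) = z ^ L`
    · refine sum_mul_waveTerm_eq_zero a y m (i' := 0) h0 (κ := z ^ L) fun w hw => ?_
      obtain ⟨h2, h3⟩ := ne_zero_of_mem_betheRoots (by omega) hNL hz hw
      have h4 : y (Fin.last n) - ((Fin.last n : Fin (n + 1)) : ℤ) - a =
          (y 0 - ((0 : Fin (n + 1)) : ℤ) - a) + ((L - (n + 1) : ℕ) : ℤ) := by
        simp only [Fin.val_last, Fin.val_zero]
        push_cast [Nat.cast_sub hNL.le]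
        linarith
      have h5 : ((Fin.last n : Fin (n + 1)) : ℤ) - 1 + 1 =
          (((0 : Fin (n + 1)) : ℤ) - 1) + ((n + 1 : ℕ) : ℤ) := by
        simp only [Fin.val_last, Fin.val_zero]
        push_cast
        ring
      have h6 : w * w ^ (((Fin.last n : Fin (n + 1)) : ℤ) - 1) =
          w ^ (((0 : Fin (n + 1)) : ℤ) - 1) * w ^ (n + 1) := by
        rw [mul_comm, ← zpow_add_one₀ h2, h5, zpow_add₀ h2, zpow_natCast]
      rw [waveFactor, waveFactor, if_pos rfl, if_neg h0.symm, h4, zpow_add₀ h3, zpow_natCast,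
        ← (mem_betheRoots (by omega) hNL).1 hw]
      linear_combination (betheWeight (n + 1) L w * (w + 1) ^ (y 0 - ((0 : Fin (n + 1)) : ℤ) - a) *
        (w + 1) ^ (L - (n + 1))) * h6

/-- The indicator function of the event that the first particle has reached `a`. -/
noncomputable def firstGE (n L : ℕ) (a : ℤ) (x : Config (n + 1) L) : ℝ :=
  if a ≤ x.1 0 then 1 else 0

lemma hasContourMean_waveCoeff (hNL : n + 1 < L) {p : ℂ} {γ : Path p p}
    (hγ : IsContourAroundZero (criticalRadius (n + 1) L) γ) (a : ℤ) (m : ℕ)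
    (y : Config (n + 1) L) :
    HasContourMean γ (waveCoeff L a m y.1) ((generator^[m] (firstGE n L a) y : ℝ) : ℂ) := by
  classical
  induction m generalizing y with
  | zero =>
    have h := hasContourMean_det_betheMoment hNL hγ a y
    have h1 : ((generator^[0] (firstGE n L a) y : ℝ) : ℂ) = if a ≤ y.1 0 then 1 else 0 := by
      simp only [Function.iterate_zero, id, firstGE]
      split_ifs <;> simp
    rw [h1]
    exact h.congr fun s => waveCoeff_zero hNL (hγ.mem s).1 a y.1
  | succ m ih =>
    rw [Function.iterate_succ_apply', generator]
    push_cast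
    refine HasContourMean.congr (HasContourMean.sum hγ Finset.univ
      (f := fun i z => if Function.update y.1 i (y.1 i + 1) ∈ Config (n + 1) L then
        waveCoeff L a m (Function.update y.1 i (y.1 i + 1)) z - waveCoeff L a m y.1 z else 0)
      fun i _ => ?_) fun s => waveCoeff_succ hNL (hγ.mem s).1 a m y.2
    by_cases h : Function.update y.1 i (y.1 i + 1) ∈ Config (n + 1) L
    · simp only [if_pos h, dif_pos h, Complex.ofReal_sub]
      exact (ih ⟨_, h⟩).sub hγ (ih y)
    · simp only [if_neg h, dif_neg h, Complex.ofReal_zero]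
      exact hasContourMean_zero

/-- The Bethe roots of all points of the contour form a compact set; outside the disc of radius `2`
the modulus of `w ^ N (w + 1) ^ (L - N)` is at least `1`, while `|z ^ L| < r_0 ^ L ≤ 1`. -/
lemma isCompact_betheRoots (hNL : n + 1 < L) {p : ℂ} {γ : Path p p}
    (hγ : IsContourAroundZero (criticalRadius (n + 1) L) γ) :
    IsCompact {w : ℂ | ∃ s, w ∈ betheRoots (n + 1) L (γ s)} ∧
      ∀ s, ∀ w ∈ betheRoots (n + 1) L (γ s), ‖w‖ ≤ 2 := by
  have hbound : ∀ s, ∀ w ∈ betheRoots (n + 1) L (γ s), ‖w‖ ≤ 2 := by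
    intro s w hw
    by_contra! h
    rw [mem_betheRoots (by omega) hNL] at hw
    have h1 : 1 ≤ ‖w + 1‖ := by
      have := norm_sub_le (w + 1) 1
      rw [add_sub_cancel_right, norm_one] at this
      linarith
    have h2 : 1 ≤ ‖w ^ (n + 1) * (w + 1) ^ (L - (n + 1))‖ := by
      rw [norm_mul, norm_pow, norm_pow]
      exact one_le_mul_of_one_le_of_one_le (one_le_pow₀ (by linarith)) (one_le_pow₀ h1)
    have h3 : criticalRadius (n + 1) L ^ L ≤ 1 := by
      have h4 := density_pos (N := n + 1) (by omega) hNL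
      have h5 := density_lt_one hNL
      rw [criticalRadius_pow (by omega) hNL]
      exact mul_le_one₀ (pow_le_one₀ h4.le h5.le) (by positivity [sub_nonneg.2 h5.le])
        (pow_le_one₀ (by linarith) (by linarith))
    have h4 : ‖γ s ^ L‖ < criticalRadius (n + 1) L ^ L := by
      rw [norm_pow]
      exact pow_lt_pow_left₀ (hγ.mem s).2 (norm_nonneg _) (by omega)
    rw [hw] at h2
    linarith
  refine ⟨?_, hbound⟩
  have hset : {w : ℂ | ∃ s, w ∈ betheRoots (n + 1) L (γ s)} =
      (fun w : ℂ => w ^ (n + 1) * (w + 1) ^ (L - (n + 1))) ⁻¹' (Set.range fun s => γ s ^ L) := by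
    ext w
    simp only [mem_betheRoots (by omega : 1 ≤ n + 1) hNL, Set.mem_ofPred_eq, Set.mem_preimage,
      Set.mem_range, eq_comm]
  have hclosed : IsClosed {w : ℂ | ∃ s, w ∈ betheRoots (n + 1) L (γ s)} := by
    rw [hset]
    exact (isCompact_range (by fun_prop)).isClosed.preimage (by fun_prop)
  refine (isCompact_closedBall (0 : ℂ) 2).of_isClosed_subset hclosed ?_
  rintro w ⟨s, hw⟩
  simpa using hbound s w hw

/-- On the contour the coefficients grow at most geometrically: the number of roots is constant, and
the summands are continuous functions of roots in a compact set which avoids the poles `0`, `-1`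
and `-ρ`. -/
lemma exists_norm_waveCoeff_le (hNL : n + 1 < L) {p : ℂ} {γ : Path p p}
    (hγ : IsContourAroundZero (criticalRadius (n + 1) L) γ) (a : ℤ) (y : Fin (n + 1) → ℤ) :
    ∃ K : ℝ, ∀ m s, ‖waveCoeff L a m y (γ s)‖ ≤ K * (2 * (n + 1)) ^ m := by
  obtain ⟨hcomp, hbound⟩ := isCompact_betheRoots hNL hγ
  set S := {w : ℂ | ∃ s, w ∈ betheRoots (n + 1) L (γ s)} with hS
  have hS0 : ∀ w ∈ S, w ≠ 0 ∧ w + 1 ≠ 0 ∧ w + density (n + 1) L ≠ 0 := by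
    rintro w ⟨s, hw⟩
    obtain ⟨h1, h2⟩ := ne_zero_of_mem_betheRoots (by omega) hNL (hγ.mem s).1 hw
    exact ⟨h1, h2, add_density_ne_zero_of_mem_betheRoots (by omega) hNL (hγ.mem s).2 hw⟩
  have hL : (L : ℂ) ≠ 0 := by exact_mod_cast (by omega : L ≠ 0)
  have hcont : ContinuousOn (fun W : Fin (n + 1) → ℂ => waveTerm L a W y)
      (Set.univ.pi fun _ => S) := by
    unfold waveTerm betheWeight
    refine ContinuousOn.mul ?_ ?_
    · simp only [Matrix.det_apply]
      refine continuousOn_finsetSum _ fun σ _ => ContinuousOn.const_smul ?_ _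
      refine continuousOn_finsetProd _ fun i _ => ?_
      exact ContinuousOn.zpow₀ (by fun_prop) _ fun W hW => Or.inl (hS0 _ (hW i trivial)).1
    · refine continuousOn_finsetProd _ fun i _ => ?_
      refine ContinuousOn.mul (ContinuousOn.mul (ContinuousOn.div (by fun_prop) (by fun_prop)
        fun W hW => mul_ne_zero hL (hS0 _ (hW i trivial)).2.2) ?_) ?_
      · exact ContinuousOn.zpow₀ (by fun_prop) _ fun W hW => Or.inl (hS0 _ (hW i trivial)).1
      · exact ContinuousOn.zpow₀ (by fun_prop) _ fun W hW => Or.inl (hS0 _ (hW i trivial)).2.1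
  obtain ⟨K, hK⟩ := (isCompact_univ_pi fun _ => hcomp).exists_bound_of_continuousOn hcont
  refine ⟨L ^ (n + 1) * K, fun m s => ?_⟩
  have hterm : ∀ W ∈ rootChoices n L (γ s),
      ‖(∑ j, W j) ^ m * waveTerm L a W y‖ ≤ (2 * (n + 1)) ^ m * K := by
    intro W hW
    rw [mem_rootChoices] at hW
    rw [norm_mul, norm_pow]
    refine mul_le_mul (pow_le_pow_left₀ (norm_nonneg _) ?_ m) (hK W fun j _ => ⟨s, hW j⟩)
      (norm_nonneg _) (by positivity)
    refine (norm_sum_le_of_le Finset.univ fun j _ => hbound s _ (hW j)).trans (le_of_eq ?_)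
    simp
    ring
  refine (norm_sum_le_of_le _ hterm).trans (le_of_eq ?_)
  rw [Finset.sum_const, rootChoices, Fintype.card_piFinset, Finset.prod_const, Finset.card_univ,
    Fintype.card_fin, (bethePoly_eq_nodal (by omega) hNL (hγ.mem s).1 (hγ.mem s).2).2, nsmul_eq_mul]
  push_cast
  ring

/-- The determinantal solution of the backward equation, the sum of the Taylor series in `t` with
the coefficients `waveCoeff`. -/
noncomputable def waveDet (L : ℕ) (a : ℤ) (t : ℝ) (y : Fin (n + 1) → ℤ) (z : ℂ) : ℂ :=
  (Matrix.of fun i j : Fin (n + 1) => betheSum (n + 1) L z fun w =>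
    Complex.exp (t * w) * (w ^ ((j : ℤ) - i - 1) * (w + 1) ^ (y j - j - a))).det

lemma hasSum_waveCoeff (hNL : n + 1 < L) {z : ℂ} (hz : 0 < ‖z‖) (a : ℤ) (t : ℝ)
    (y : Fin (n + 1) → ℤ) :
    HasSum (fun m : ℕ => (t : ℂ) ^ m / m.factorial * waveCoeff L a m y z) (waveDet L a t y z) := by
  rw [waveDet, det_betheSum hNL hz]
  simp only [waveCoeff, Finset.mul_sum]
  refine hasSum_sum fun W _ => ?_
  rw [← Complex.exp_sum, ← Finset.mul_sum, Complex.exp_eq_exp_ℂ]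
  have := (NormedSpace.expSeries_div_hasSum_exp (𝔸 := ℂ) (t * ∑ j, W j)).mul_right
    (waveTerm L a W y)
  refine this.congr_fun fun m => ?_
  rw [mul_pow]
  ring

/-- The mean of `waveDet` is the exponential series of the generator, applied to the indicator
function of the event that the first particle has reached `a`. -/
theorem waveDet_contourMean (hNL : n + 1 < L) {p : ℂ} {γ : Path p p}
    (hγ : IsContourAroundZero (criticalRadius (n + 1) L) γ) (a : ℤ) (t : ℝ)
    (y : Config (n + 1) L) :
    ContinuousOn (waveDet L a t y.1) (Set.range γ) ∧
      HasSum (fun m : ℕ => (((t ^ m / m.factorial * generator^[m] (firstGE n L a) y : ℝ)) : ℂ))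
        (curveIntegral (logForm (waveDet L a t y.1)) γ) := by
  obtain ⟨K, hK⟩ := exists_norm_waveCoeff_le hNL hγ a y.1
  refine HasContourMean.of_hasSum hγ
    (F := fun m z => (t : ℂ) ^ m / m.factorial * waveCoeff L a m y.1 z)
    (b := fun m => K * ((|t| * (2 * (n + 1))) ^ m / m.factorial)) (fun m => ?_) ?_ ?_ ?_
  · have := (hasContourMean_waveCoeff hNL hγ a m y).const_mul ((t : ℂ) ^ m / m.factorial)
    push_cast
    exact this
  · exact (Real.summable_pow_div_factorial _).mul_left K
  · intro m s
    rw [norm_mul, norm_div, norm_pow, Complex.norm_real, Real.norm_eq_abs, Complex.norm_natCast,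
      mul_pow]
    calc |t| ^ m / m.factorial * ‖waveCoeff L a m y.1 (γ s)‖
        ≤ |t| ^ m / m.factorial * (K * (2 * (n + 1)) ^ m) :=
          mul_le_mul_of_nonneg_left (hK m s) (by positivity)
      _ = _ := by ring
  · exact fun s => hasSum_waveCoeff hNL (hγ.mem s).1 a t y.1

end Evolution

/-! ### The branches of the inverse of `w (w + 1) ^ (d - 1)` -/

section Branches

/-- The fixed points of the maps `w ↦ a₀ + c h(w)`, contractions of `H` for `|c| < R`, depend
continuously on `c`. -/
lemma exists_fixedPoint_family {H : Set ℂ} (hH : IsClosed H) (hne : H.Nonempty) {h : ℂ → ℂ}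
    {a₀ : ℂ} {A B R : ℝ} (hA : ∀ w ∈ H, ‖h w‖ ≤ A)
    (hB : ∀ w ∈ H, ∀ w' ∈ H, ‖h w - h w'‖ ≤ B * ‖w - w'‖) (hB0 : 0 < B) (hRB : R * B ≤ 1)
    (hmaps : ∀ c, ‖c‖ < R → ∀ w ∈ H, a₀ + c * h w ∈ H) :
    ∃ φ : ℂ → ℂ, (∀ c, ‖c‖ < R → φ c ∈ H ∧ φ c = a₀ + c * h (φ c) ∧
      ∀ w ∈ H, w = a₀ + c * h w → w = φ c) ∧ ContinuousOn φ (Metric.ball 0 R) := by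
  have hcB : ∀ c : ℂ, ‖c‖ < R → ‖c‖ * B < 1 := fun c hc =>
    (mul_lt_mul_of_pos_right hc hB0).trans_le hRB
  have hex : ∀ c : ℂ, ‖c‖ < R → ∃ w ∈ H, w = a₀ + c * h w := by
    intro c hc
    obtain ⟨x, hx⟩ := hne
    have hm : Set.MapsTo (fun w => a₀ + c * h w) H H := fun w hw => hmaps c hc w hw
    have hcon : ContractingWith (‖c‖ * B).toNNReal (hm.restrict _ H H) := by
      refine ⟨?_, LipschitzWith.of_dist_le_mul fun w w' => ?_⟩
      · rw [← NNReal.coe_lt_coe, Real.coe_toNNReal _ (by positivity)]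
        exact hcB c hc
      · rw [Subtype.dist_eq, Subtype.dist_eq, dist_eq_norm, dist_eq_norm]
        simp only [Set.MapsTo.val_restrict_apply]
        rw [Real.coe_toNNReal _ (by positivity), add_sub_add_left_eq_sub, ← mul_sub, norm_mul,
          mul_assoc]
        exact mul_le_mul_of_nonneg_left (hB _ w.2 _ w'.2) (norm_nonneg c)
    obtain ⟨y, hy, hfix, -⟩ := hcon.exists_fixedPoint' hH.isComplete hm hx (edist_ne_top _ _)
    exact ⟨y, hy, hfix.symm⟩
  have hex' : ∀ c : ℂ, ∃ w, ‖c‖ < R → w ∈ H ∧ w = a₀ + c * h w := by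
    intro c
    by_cases hc : ‖c‖ < R
    · obtain ⟨w, hw⟩ := hex c hc
      exact ⟨w, fun _ => hw⟩
    · exact ⟨0, fun h => absurd h hc⟩
  choose φ hφ using hex'
  have hdist : ∀ c c' : ℂ, ‖c‖ < R → ∀ w ∈ H, ∀ w' ∈ H, w = a₀ + c * h w →
      w' = a₀ + c' * h w' → (1 - ‖c‖ * B) * ‖w - w'‖ ≤ ‖c - c'‖ * A := by
    intro c c' _ w hw w' hw' h1 h2
    have h3 : w - w' = c * (h w - h w') + (c - c') * h w' := by
      linear_combination h1 - h2
    have h4 : ‖w - w'‖ ≤ ‖c‖ * (B * ‖w - w'‖) + ‖c - c'‖ * A := by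
      conv_lhs => rw [h3]
      refine (norm_add_le _ _).trans (add_le_add ?_ ?_)
      · rw [norm_mul]
        exact mul_le_mul_of_nonneg_left (hB w hw w' hw') (norm_nonneg _)
      · rw [norm_mul]
        exact mul_le_mul_of_nonneg_left (hA w' hw') (norm_nonneg _)
    linarith
  refine ⟨φ, fun c hc => ⟨(hφ c hc).1, (hφ c hc).2, fun w hw hw' => ?_⟩, fun c hc => ?_⟩
  · have h1 := hdist c c hc w hw (φ c) (hφ c hc).1 hw' (hφ c hc).2
    rw [sub_self, norm_zero, zero_mul] at h1
    have h2 : 0 < 1 - ‖c‖ * B := sub_pos.2 (hcB c hc)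
    have h3 : ‖w - φ c‖ ≤ 0 := by
      by_contra! h
      exact absurd h1 (mul_pos h2 h).not_ge
    exact sub_eq_zero.1 (norm_le_zero_iff.1 h3)
  · rw [mem_ball_zero_iff] at hc
    have h2 : 0 < 1 - ‖c‖ * B := sub_pos.2 (hcB c hc)
    rw [ContinuousWithinAt, tendsto_iff_norm_sub_tendsto_zero]
    have h0 : Filter.Tendsto (fun c' => ‖c - c'‖ * A / (1 - ‖c‖ * B))
        (nhdsWithin c (Metric.ball 0 R)) (nhds 0) := by
      have : Continuous fun c' : ℂ => ‖c - c'‖ * A / (1 - ‖c‖ * B) := by fun_prop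
      have h5 := (this.tendsto c).mono_left (nhdsWithin_le_nhds (s := Metric.ball 0 R))
      simpa using h5
    refine squeeze_zero' (Filter.Eventually.of_forall fun _ => norm_nonneg _) ?_ h0
    filter_upwards [self_mem_nhdsWithin] with c' hc'
    rw [mem_ball_zero_iff] at hc'
    rw [le_div_iff₀ h2, norm_sub_rev, mul_comm]
    exact hdist c c' hc _ (hφ c hc).1 _ (hφ c' hc').1 (hφ c hc).2 (hφ c' hc').2

variable {e : ℕ}

/-- The density `ρ = 1 / d` for `d = e + 1`. -/
noncomputable def flatDensity (e : ℕ) : ℝ := ((e : ℝ) + 1)⁻¹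

/-- The value `ρ (1 - ρ) ^ (d - 1)` of `|w (w + 1) ^ (d - 1)|` at the critical point `-ρ`, where
`d = e + 1`. -/
noncomputable def flatRadius (e : ℕ) : ℝ := flatDensity e * (1 - flatDensity e) ^ e

lemma flatDensity_pos : 0 < flatDensity e := by
  unfold flatDensity
  positivity

lemma one_sub_flatDensity : 1 - flatDensity e = e * flatDensity e := by
  unfold flatDensity
  field_simp
  ring

lemma one_sub_flatDensity_pos (he : 1 ≤ e) : 0 < 1 - flatDensity e := by
  rw [one_sub_flatDensity]
  have : (0 : ℝ) < e := by exact_mod_cast he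
  exact mul_pos this flatDensity_pos

/-- `φ` inverts `w (w + 1) ^ e` on the disc of radius `flatRadius e`, with values in the half plane
`Re w > -ρ`. -/
structure IsRightBranch (e : ℕ) (φ : ℂ → ℂ) : Prop where
  spec : ∀ θ, ‖θ‖ < flatRadius e → -flatDensity e < (φ θ).re ∧ φ θ * (φ θ + 1) ^ e = θ ∧
    ∀ w : ℂ, -flatDensity e ≤ w.re → w * (w + 1) ^ e = θ → w = φ θ
  continuousOn : ContinuousOn φ (Metric.ball 0 (flatRadius e))

/-- `ψ` parametrizes the solutions of `w (w + 1) ^ e = θ` in the half plane `Re w < -ρ` by the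
`e`-th roots `c` of `-θ`; this resolves the branch point `w = -1` at `θ = 0`. -/
structure IsLeftBranch (e : ℕ) (ψ : ℂ → ℂ) : Prop where
  spec : ∀ c, ‖c‖ ^ e < flatRadius e → (ψ c).re < -flatDensity e ∧ ψ c * (ψ c + 1) ^ e = -c ^ e
  surj : ∀ w : ℂ, w.re ≤ -flatDensity e → ‖w * (w + 1) ^ e‖ < flatRadius e →
    ∃ c, -c ^ e = w * (w + 1) ^ e ∧ ψ c = w
  inj : ∀ c c', ‖c‖ ^ e < flatRadius e → ‖c'‖ ^ e < flatRadius e → ψ c = ψ c' → c = c'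
  apply_zero : ψ 0 = -1
  continuousOn : ContinuousOn ψ {c | ‖c‖ ^ e < flatRadius e}

/-- For `|θ| < ρ (1 - ρ) ^ (d - 1)` the equation `w (w + 1) ^ (d - 1) = θ` has exactly one solution
in the half plane `Re w ≥ -ρ`: there `w ↦ θ / (w + 1) ^ (d - 1)` is a contraction. -/
lemma exists_rightBranch (he : 1 ≤ e) : ∃ φ, IsRightBranch e φ := by
  have hρ := flatDensity_pos (e := e)
  have hρ1 := one_sub_flatDensity_pos he
  set ρ := flatDensity e with hρdef
  set H : Set ℂ := {w | -ρ ≤ w.re} with hHdef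
  have hnorm : ∀ w ∈ H, 1 - ρ ≤ ‖w + 1‖ := by
    intro w hw
    have h1 : -ρ ≤ w.re := hw
    refine le_trans ?_ (Complex.re_le_norm _)
    simp only [Complex.add_re, Complex.one_re]
    linarith
  have hne0 : ∀ w ∈ H, w + 1 ≠ 0 := fun w hw => norm_pos_iff.1 (hρ1.trans_le (hnorm w hw))
  have hA : ∀ w ∈ H, ‖((w + 1) ^ e)⁻¹‖ ≤ ((1 - ρ) ^ e)⁻¹ := by
    intro w hw
    rw [norm_inv, norm_pow]
    exact inv_anti₀ (by positivity) (pow_le_pow_left₀ hρ1.le (hnorm w hw) e)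
  have hconv : Convex ℝ H := convex_halfSpace_re_ge _
  have hB : ∀ w ∈ H, ∀ w' ∈ H, ‖((w + 1) ^ e)⁻¹ - ((w' + 1) ^ e)⁻¹‖ ≤
      (e * ((1 - ρ) ^ (e + 1))⁻¹) * ‖w - w'‖ := by
    intro w hw w' hw'
    refine hconv.norm_image_sub_le_of_norm_hasDerivWithin_le
      (f := fun w : ℂ => ((w + 1) ^ e)⁻¹)
      (f' := fun w => -(e * (w + 1) ^ (e - 1)) / ((w + 1) ^ e) ^ 2) (fun x hx => ?_)
      (fun x hx => ?_) hw' hw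
    · have h1 := (((hasDerivAt_id x).add_const 1).pow e).inv (pow_ne_zero e (hne0 x hx))
      simp only [id, mul_one] at h1
      exact h1.hasDerivWithinAt
    · have h2 : -(e * (x + 1) ^ (e - 1)) / ((x + 1) ^ e) ^ 2 = -(e * ((x + 1) ^ (e + 1))⁻¹) := by
        have h0 := hne0 x hx
        obtain ⟨k, rfl⟩ : ∃ k, e = k + 1 := ⟨e - 1, by omega⟩
        simp only [Nat.add_sub_cancel]
        field_simp
        ring
      rw [h2, norm_neg, norm_mul, Complex.norm_natCast, norm_inv, norm_pow]
      refine mul_le_mul_of_nonneg_left ?_ (by positivity)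
      exact inv_anti₀ (by positivity) (pow_le_pow_left₀ hρ1.le (hnorm x hx) _)
  have hbd : ∀ θ : ℂ, ‖θ‖ < flatRadius e → ∀ w ∈ H, ‖θ * ((w + 1) ^ e)⁻¹‖ < ρ := by
    intro θ hθ w hw
    rw [norm_mul]
    calc ‖θ‖ * ‖((w + 1) ^ e)⁻¹‖ ≤ ‖θ‖ * ((1 - ρ) ^ e)⁻¹ :=
          mul_le_mul_of_nonneg_left (hA w hw) (norm_nonneg _)
      _ < flatRadius e * ((1 - ρ) ^ e)⁻¹ := mul_lt_mul_of_pos_right hθ (by positivity)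
      _ = ρ := by
        rw [flatRadius, ← hρdef, mul_assoc, mul_inv_cancel₀ (by positivity), mul_one]
  have hre : ∀ θ : ℂ, ‖θ‖ < flatRadius e → ∀ w ∈ H, -ρ < (0 + θ * ((w + 1) ^ e)⁻¹).re := by
    intro θ hθ w hw
    have h1 := hbd θ hθ w hw
    have h2 := Complex.abs_re_le_norm (θ * ((w + 1) ^ e)⁻¹)
    rw [zero_add]
    linarith [neg_abs_le (θ * ((w + 1) ^ e)⁻¹).re]
  have he0 : (0 : ℝ) < e := by exact_mod_cast he
  obtain ⟨φ, h1, h2⟩ := exists_fixedPoint_family (R := flatRadius e) (a₀ := 0)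
    (isClosed_le continuous_const Complex.continuous_re)
    ⟨0, by simp [hρ.le]⟩ hA hB (by positivity) (by
      rw [flatRadius, ← hρdef, pow_succ, mul_inv]
      have h3 : 1 - ρ = e * ρ := one_sub_flatDensity
      refine le_of_eq ?_
      have : ρ * (1 - ρ) ^ e * (e * (((1 - ρ) ^ e)⁻¹ * (1 - ρ)⁻¹)) =
        (e * ρ) * (1 - ρ)⁻¹ * ((1 - ρ) ^ e * ((1 - ρ) ^ e)⁻¹) := by ring
      rw [this, mul_inv_cancel₀ (by positivity), ← h3, mul_inv_cancel₀ hρ1.ne', one_mul])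
    (fun θ hθ w hw => (hre θ hθ w hw).le)
  refine ⟨φ, fun θ hθ => ?_, h2⟩
  obtain ⟨h3, h4, h5⟩ := h1 θ hθ
  refine ⟨?_, ?_, fun w hw hwθ => h5 w hw ?_⟩
  · have := hre θ hθ _ h3
    rwa [← h4] at this
  · have h0 := pow_ne_zero e (hne0 _ h3)
    rw [zero_add] at h4
    conv_lhs => enter [1]; rw [h4]
    rw [mul_assoc, inv_mul_cancel₀ h0, mul_one]
  · have h0 := pow_ne_zero e (hne0 _ hw)
    rw [← hwθ, zero_add, mul_assoc, mul_inv_cancel₀ h0, mul_one]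

/-- The solutions of `w (w + 1) ^ (d - 1) = θ` in the half plane `Re w ≤ -ρ` are the fixed points of
the contractions `w ↦ -1 + c (-w) ^ (-1 / (d - 1))` with `c ^ (d - 1) = -θ`. -/
lemma exists_leftBranch (he : 1 ≤ e) : ∃ ψ, IsLeftBranch e ψ := by
  have hρ := flatDensity_pos (e := e)
  have hρ1 := one_sub_flatDensity_pos he
  have he0 : (0 : ℝ) < e := by exact_mod_cast he
  set ρ := flatDensity e with hρdef
  set H : Set ℂ := {w | w.re ≤ -ρ} with hHdef
  set q : ℝ := (e : ℝ)⁻¹ with hq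
  have hq0 : 0 < q := by positivity
  have hnorm : ∀ w ∈ H, ρ ≤ ‖-w‖ := by
    intro w hw
    have h1 : w.re ≤ -ρ := hw
    refine le_trans ?_ (Complex.re_le_norm _)
    simp only [Complex.neg_re]
    linarith
  have hne0 : ∀ w ∈ H, -w ≠ 0 := fun w hw => norm_pos_iff.1 (hρ.trans_le (hnorm w hw))
  have hpow : ∀ r : ℝ, ∀ w ∈ H, ‖(-w) ^ ((-r : ℝ) : ℂ)‖ = ‖-w‖ ^ (-r) := by
    intro r w hw
    exact Complex.norm_cpow_real _ _
  have hA : ∀ w ∈ H, ‖(-w) ^ ((-q : ℝ) : ℂ)‖ ≤ ρ ^ (-q) := by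
    intro w hw
    rw [hpow q w hw]
    exact Real.rpow_le_rpow_of_nonpos hρ (hnorm w hw) (by linarith)
  have hconv : Convex ℝ H := convex_halfSpace_re_le _
  have hB : ∀ w ∈ H, ∀ w' ∈ H, ‖(-w) ^ ((-q : ℝ) : ℂ) - (-w') ^ ((-q : ℝ) : ℂ)‖ ≤
      (q * ρ ^ (-(q + 1))) * ‖w - w'‖ := by
    intro w hw w' hw'
    refine hconv.norm_image_sub_le_of_norm_hasDerivWithin_le
      (f := fun w : ℂ => (-w) ^ ((-q : ℝ) : ℂ))
      (f' := fun w => ((-q : ℝ) : ℂ) * (-w) ^ (((-q : ℝ) : ℂ) - 1) * (-1)) (fun x hx => ?_)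
      (fun x hx => ?_) hw' hw
    · have hs : -x ∈ Complex.slitPlane := by
        left
        have : x.re ≤ -ρ := hx
        simp only [Complex.neg_re]
        linarith
      exact ((hasDerivAt_neg x).cpow_const hs).hasDerivWithinAt
    · have h2 : ((-q : ℝ) : ℂ) - 1 = ((-(q + 1) : ℝ) : ℂ) := by push_cast; ring
      rw [h2, mul_neg_one, norm_neg, norm_mul, hpow _ x hx, Complex.norm_real, norm_neg,
        Real.norm_of_nonneg hq0.le]
      exact mul_le_mul_of_nonneg_left
        (Real.rpow_le_rpow_of_nonpos hρ (hnorm x hx) (by linarith)) hq0.le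
  set R : ℝ := (1 - ρ) * ρ ^ q with hR
  have hR0 : 0 < R := by positivity
  have hRe : R ^ e = flatRadius e := by
    rw [hR, mul_pow, ← Real.rpow_natCast (ρ ^ q), ← Real.rpow_mul hρ.le, hq,
      inv_mul_cancel₀ he0.ne', Real.rpow_one, flatRadius, mul_comm]
  have hiff : ∀ c : ℂ, ‖c‖ ^ e < flatRadius e ↔ ‖c‖ < R := by
    intro c
    rw [← hRe]
    exact pow_lt_pow_iff_left₀ (norm_nonneg c) hR0.le (by omega)
  have hRA : R * ρ ^ (-q) = 1 - ρ := by
    rw [hR, mul_assoc, ← Real.rpow_add hρ, add_neg_cancel, Real.rpow_zero, mul_one]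
  have hre : ∀ c : ℂ, ‖c‖ < R → ∀ w ∈ H, (-1 + c * (-w) ^ ((-q : ℝ) : ℂ)).re < -ρ := by
    intro c hc w hw
    have h1 : ‖c * (-w) ^ ((-q : ℝ) : ℂ)‖ < 1 - ρ := by
      rw [norm_mul, ← hRA]
      calc ‖c‖ * ‖(-w) ^ ((-q : ℝ) : ℂ)‖ ≤ ‖c‖ * ρ ^ (-q) :=
            mul_le_mul_of_nonneg_left (hA w hw) (norm_nonneg _)
        _ < R * ρ ^ (-q) := mul_lt_mul_of_pos_right hc (by positivity)
    have h2 := Complex.re_le_norm (c * (-w) ^ ((-q : ℝ) : ℂ))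
    rw [Complex.add_re, Complex.neg_re, Complex.one_re]
    linarith
  obtain ⟨φ, h1, h2⟩ := exists_fixedPoint_family (R := R) (a₀ := -1)
    (isClosed_le Complex.continuous_re continuous_const)
    ⟨-1, by simp; linarith⟩ hA hB (by positivity) (by
      have h3 : 1 - ρ = e * ρ := one_sub_flatDensity
      have h4 : ρ ^ q * ρ ^ (-(q + 1)) = ρ⁻¹ := by
        rw [← Real.rpow_add hρ, show q + -(q + 1) = -1 by ring, Real.rpow_neg_one]
      have h5 : R * (q * ρ ^ (-(q + 1))) = (1 - ρ) * q * (ρ ^ q * ρ ^ (-(q + 1))) := by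
        rw [hR]
        ring
      rw [h5, h4, h3, hq]
      refine le_of_eq ?_
      field_simp)
    (fun c hc w hw => (hre c hc w hw).le)
  -- the `e`-th power of `(-w) ^ (1 / e)`
  have hqe : ∀ w ∈ H, ((-w) ^ ((-q : ℝ) : ℂ)) ^ e = (-w)⁻¹ := by
    intro w hw
    rw [← Complex.cpow_nat_mul, ← Complex.cpow_neg_one]
    congr 1
    rw [hq]
    push_cast
    have : (e : ℂ) ≠ 0 := by exact_mod_cast he0.ne'
    field_simp
  have hcpow : ∀ w ∈ H, (-w) ^ ((-q : ℝ) : ℂ) ≠ 0 := by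
    intro w hw h
    have := hqe w hw
    rw [h, zero_pow (by omega)] at this
    exact inv_ne_zero (hne0 w hw) this.symm
  refine ⟨φ, fun c hc => ?_, fun w hw hwR => ?_, fun c c' hc hc' hcc => ?_, ?_, ?_⟩
  · rw [hiff] at hc
    obtain ⟨h3, h4, h5⟩ := h1 c hc
    refine ⟨?_, ?_⟩
    · have := hre c hc _ h3
      rwa [← h4] at this
    · have h6 : φ c + 1 = c * (-φ c) ^ ((-q : ℝ) : ℂ) := by linear_combination h4
      rw [h6, mul_pow, hqe _ h3]
      have := hne0 _ h3
      have h7 : φ c ≠ 0 := neg_ne_zero.1 this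
      field_simp
  · refine ⟨(w + 1) * ((-w) ^ ((-q : ℝ) : ℂ))⁻¹, ?_, ?_⟩
    · rw [mul_pow, inv_pow, hqe w hw, inv_inv]
      ring
    · symm
      have hc : -((w + 1) * ((-w) ^ ((-q : ℝ) : ℂ))⁻¹) ^ e = w * (w + 1) ^ e := by
        rw [mul_pow, inv_pow, hqe w hw, inv_inv]
        ring
      refine (h1 _ ?_).2.2 w hw ?_
      · rw [← hiff, ← norm_pow, ← norm_neg, hc]
        exact hwR
      · rw [mul_assoc, inv_mul_cancel₀ (hcpow w hw)]
        ring
  · rw [hiff] at hc hc'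
    have h3 := (h1 c hc).2.1
    have h4 := (h1 c' hc').2.1
    rw [← hcc] at h4
    have h5 := hcpow _ (h1 c hc).1
    refine mul_right_cancel₀ h5 ?_
    linear_combination h4 - h3
  · have := (h1 0 (by simpa using hR0)).2.1
    simpa using this
  · refine h2.mono fun c hc => ?_
    rw [mem_ball_zero_iff, ← hiff]
    exact hc

end Branches

/-! ### Labelling of the Bethe roots and the product of square roots -/

section FlatRoots

open Polynomial

variable {e : ℕ} {φ ψ : ℂ → ℂ}

lemma flatRadius_pos (he : 1 ≤ e) : 0 < flatRadius e := by
  unfold flatRadius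
  have h1 := one_sub_flatDensity_pos he
  have h2 := flatDensity_pos (e := e)
  positivity

lemma IsRightBranch.apply_zero (he : 1 ≤ e) (hφ : IsRightBranch e φ) : φ 0 = 0 := by
  have := (hφ.spec 0 (by simpa using flatRadius_pos he)).2.2 0
    (by simpa using flatDensity_pos.le) (by simp)
  exact this.symm

lemma norm_pow_eq_of_pow_eq {c θ : ℂ} (h : c ^ e = -θ) : ‖c‖ ^ e = ‖θ‖ := by
  rw [← norm_pow, h, norm_neg]

/-- The factorization of `w (w + 1) ^ e - θ`, and its derivative at the right root. -/
lemma branch_factorization (he : 1 ≤ e) (hφ : IsRightBranch e φ) (hψ : IsLeftBranch e ψ) {θ : ℂ}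
    (hθ : ‖θ‖ < flatRadius e) {c : Fin e → ℂ} (hc : ∀ j, c j ^ e = -θ)
    (hcinj : Function.Injective c) :
    (∀ w, w * (w + 1) ^ e - θ = (w - φ θ) * ∏ j, (w - ψ (c j))) ∧
      ∏ j, (φ θ - ψ (c j)) =
        (φ θ + 1) ^ (e - 1) * ((e + 1) * (φ θ + flatDensity e)) := by
  have hcR : ∀ j, ‖c j‖ ^ e < flatRadius e := fun j => by
    rwa [norm_pow_eq_of_pow_eq (hc j)]
  obtain ⟨hv1, hv2, -⟩ := hφ.spec θ hθ
  set x : Option (Fin e) → ℂ := fun o => o.elim (φ θ) fun j => ψ (c j) with hx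
  have hxinj : Function.Injective x := by
    rintro (_ | j) (_ | j') h
    · rfl
    · have := (hψ.spec _ (hcR j')).1
      simp only [hx, Option.elim] at h
      rw [h] at hv1
      exact absurd this hv1.not_gt
    · have := (hψ.spec _ (hcR j)).1
      simp only [hx, Option.elim] at h
      rw [← h] at hv1
      exact absurd this hv1.not_gt
    · rw [hcinj (hψ.inj _ _ (hcR j) (hcR j') h)]
  set p : ℂ[X] := X * (X + 1) ^ e - C θ with hp
  have hm1 : (X + 1 : ℂ[X]).Monic := monic_X_add_C 1
  have hm : (X * (X + 1) ^ e : ℂ[X]).Monic := monic_X.mul (hm1.pow _)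
  have hd : (X * (X + 1) ^ e : ℂ[X]).natDegree = e + 1 := by
    rw [monic_X.natDegree_mul (hm1.pow _), natDegree_X, hm1.natDegree_pow,
      show (X + 1 : ℂ[X]).natDegree = 1 from natDegree_X_add_C 1]
    ring
  have hlt : (C θ).degree < (X * (X + 1) ^ e : ℂ[X]).degree := by
    refine lt_of_le_of_lt degree_C_le ?_
    rw [degree_eq_natDegree hm.ne_zero, hd]
    exact_mod_cast Nat.succ_pos e
  have hpm : p.Monic := hm.sub_of_left hlt
  have hpd : p.degree = (e + 1 : ℕ) := by
    rw [hp, degree_sub_eq_left_of_degree_lt hlt, degree_eq_natDegree hm.ne_zero, hd]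
  have hcard : Fintype.card (Option (Fin e)) = e + 1 := by simp
  have hnd : (Lagrange.nodal Finset.univ x).degree = (e + 1 : ℕ) := by
    rw [Lagrange.degree_nodal, Finset.card_univ, hcard]
  have hpn : p = Lagrange.nodal Finset.univ x := by
    refine Polynomial.eq_of_degree_sub_lt_of_eval_index_eq (v := x) Finset.univ
      hxinj.injOn ?_ ?_
    · rw [Finset.card_univ, hcard, ← hpd]
      exact degree_sub_lt_left (hpd.trans hnd.symm) hpm.ne_zero
        (hpm.leadingCoeff.trans (Lagrange.nodal_monic).leadingCoeff.symm)
    · intro o _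
      rw [Lagrange.eval_nodal_at_node (Finset.mem_univ o)]
      rcases o with _ | j
      · simp [hp, hx, hv2]
      · simp [hp, hx, (hψ.spec _ (hcR j)).2, hc]
  have hfac : p = (X - C (φ θ)) * ∏ j, (X - C (ψ (c j))) := by
    rw [hpn, Lagrange.nodal, Fintype.prod_option]
    rfl
  constructor
  · intro w
    have := congrArg (eval w) hfac
    simpa [hp, eval_prod] using this
  · have := congrArg (fun P => (derivative P).eval (φ θ)) hfac
    simp only [derivative_mul, derivative_sub, derivative_X, derivative_C, eval_add, eval_mul,
      eval_sub, eval_X, eval_C, sub_self, zero_mul, add_zero, sub_zero, one_mul,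
      eval_prod] at this
    rw [← this, hp]
    have h2 : (flatDensity e : ℂ) = ((e : ℂ) + 1)⁻¹ := by
      unfold flatDensity
      push_cast
      rfl
    have h3 : (e : ℂ) + 1 ≠ 0 := by exact_mod_cast Nat.succ_ne_zero e
    obtain ⟨k, rfl⟩ : ∃ k, e = k + 1 := ⟨e - 1, by omega⟩
    rw [mul_add _ _ (flatDensity (k + 1) : ℂ), h2, mul_inv_cancel₀ h3]
    simp only [derivative_sub, derivative_mul, derivative_pow, derivative_X, derivative_add,
      derivative_one, derivative_C, eval_sub, eval_add, eval_mul, eval_pow, eval_X, eval_one,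
      eval_C, eval_zero, Nat.add_sub_cancel]
    push_cast
    ring

lemma csqrt_sq (a : ℂ) : Complex.sqrt a ^ 2 = a := by
  rw [Complex.sqrt, ← Complex.cpow_nat_mul]
  norm_num

lemma continuousAt_csqrt {a : ℂ} (ha : 0 < a.re) : ContinuousAt Complex.sqrt a :=
  continuousAt_cpow_const (Or.inl ha)

lemma csqrt_ne_zero {a : ℂ} (ha : 0 < a.re) : Complex.sqrt a ≠ 0 := by
  intro h
  have := csqrt_sq a
  rw [h, zero_pow two_ne_zero] at this
  rw [← this] at ha
  simp at ha

variable {N : ℕ}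

/-- The square of `prod_csqrt_eq`: in the product over pairs, the factor for `l ≠ m` cancels the
factors `φ (θ l) - ψ (c m j)`, whose product over `j` is `(θ l - θ m) / (φ (θ l) - φ (θ m))`. -/
lemma prod_sub_sq_eq (he : 1 ≤ e) (hφ : IsRightBranch e φ) (hψ : IsLeftBranch e ψ) {θ : Fin N → ℂ}
    (hθ : Function.Injective θ) (hθR : ∀ l, ‖θ l‖ < flatRadius e) {c : Fin N → Fin e → ℂ}
    (hc : ∀ l j, c l j ^ e = -θ l) (hcinj : ∀ l, Function.Injective (c l)) :
    (∏ l, ∏ m ∈ Finset.Ioi l, (φ (θ m) - φ (θ l)) / (θ m - θ l)) ^ 2 *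
      ∏ l, ∏ m, ∏ j, (φ (θ l) - ψ (c m j)) =
    ∏ l, (φ (θ l) + 1) ^ (e - 1) * ((e + 1) * (φ (θ l) + flatDensity e)) := by
  have hfac := fun l => branch_factorization he hφ hψ (hθR l) (hc l) (hcinj l)
  set r : Fin N → Fin N → ℂ := fun l m => (φ (θ m) - φ (θ l)) / (θ m - θ l) with hr
  have hsymm : ∀ l m, r l m = r m l := by
    intro l m
    simp only [hr]
    rw [← neg_sub (φ (θ l)), ← neg_sub (θ l), neg_div_neg_eq]
  have h1 : (∏ l, ∏ m ∈ Finset.Ioi l, r l m) ^ 2 = ∏ l, ∏ m ∈ {l}ᶜ, r m l := by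
    rw [← Finset.prod_prod_Ioi_mul_eq_prod_prod_off_diag, pow_two, ← Finset.prod_mul_distrib]
    refine Finset.prod_congr rfl fun l _ => ?_
    rw [← Finset.prod_mul_distrib]
    refine Finset.prod_congr rfl fun m _ => ?_
    rw [hsymm m l]
  change (∏ l, ∏ m ∈ Finset.Ioi l, r l m) ^ 2 * _ = _
  rw [h1, ← Finset.prod_mul_distrib]
  refine Finset.prod_congr rfl fun l _ => ?_
  have h2 : ∏ m, ∏ j, (φ (θ l) - ψ (c m j)) =
      (∏ j, (φ (θ l) - ψ (c l j))) * ∏ m ∈ {l}ᶜ, ∏ j, (φ (θ l) - ψ (c m j)) := by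
    rw [Fintype.prod_eq_mul_prod_compl l]
  rw [h2, mul_left_comm, ← Finset.prod_mul_distrib, (hfac l).2]
  rw [Finset.prod_eq_one fun m hm => ?_, mul_one]
  have hml : m ≠ l := by simpa using hm
  have h3 := (hfac m).1 (φ (θ l))
  rw [(hφ.spec _ (hθR l)).2.1] at h3
  have h4 : θ l - θ m ≠ 0 := sub_ne_zero.2 fun h => hml (hθ h).symm
  simp only [hr]
  rw [div_mul_eq_mul_div, ← h3, div_self h4]

/-- The identity which turns Vandermonde determinants into the product of square roots in the
prefactor. The squares of both sides agree, and the sign is found by following the roots along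
`θ ↦ s ^ e θ` to `s = 0`, where the right roots reach `0`, the left roots reach `-1`, and both sides
become `1`. -/
lemma prod_csqrt_eq (he : 1 ≤ e) (hφ : IsRightBranch e φ) (hψ : IsLeftBranch e ψ) {θ : Fin N → ℂ}
    (hθ : Function.Injective θ) (hθR : ∀ l, ‖θ l‖ < flatRadius e) {c : Fin N → Fin e → ℂ}
    (hc : ∀ l j, c l j ^ e = -θ l) (hcinj : ∀ l, Function.Injective (c l)) :
    (∏ l, ∏ m ∈ Finset.Ioi l, (φ (θ m) - φ (θ l)) / (θ m - θ l)) *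
      ∏ l, ∏ m, ∏ j, Complex.sqrt (φ (θ l) - ψ (c m j)) =
    ∏ l, Complex.sqrt (φ (θ l) + 1) ^ (e - 1) *
      Complex.sqrt ((e + 1) * (φ (θ l) + flatDensity e)) := by
  have he0 : e ≠ 0 := by omega
  have hρ := flatDensity_pos (e := e)
  have hρ1 := one_sub_flatDensity_pos he
  set I : Set ℝ := Set.Icc 0 1 with hI
  set θs : ℝ → Fin N → ℂ := fun s l => (s : ℂ) ^ e * θ l with hθs
  set cs : ℝ → Fin N → Fin e → ℂ := fun s l j => s * c l j with hcs
  set v : ℝ → Fin N → ℂ := fun s l => φ (θs s l) with hv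
  set u : ℝ → Fin N → Fin e → ℂ := fun s l j => ψ (cs s l j) with hu
  have hsn : ∀ s ∈ I, ‖(s : ℂ) ^ e‖ ≤ 1 := by
    intro s hs
    rw [norm_pow, Complex.norm_real, Real.norm_of_nonneg hs.1]
    exact pow_le_one₀ hs.1 hs.2
  have hθsR : ∀ s ∈ I, ∀ l, ‖θs s l‖ < flatRadius e := by
    intro s hs l
    refine lt_of_le_of_lt ?_ (hθR l)
    rw [hθs, norm_mul]
    exact mul_le_of_le_one_left (norm_nonneg _) (hsn s hs)
  have hcsp : ∀ s l j, cs s l j ^ e = -θs s l := by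
    intro s l j
    simp only [hcs, hθs, mul_pow, hc]
    ring
  have hcsR : ∀ s ∈ I, ∀ l j, ‖cs s l j‖ ^ e < flatRadius e := by
    intro s hs l j
    rw [norm_pow_eq_of_pow_eq (hcsp s l j)]
    exact hθsR s hs l
  have hvc : ∀ l, ContinuousOn (fun s => v s l) I := fun l =>
    hφ.continuousOn.comp (by fun_prop) fun s hs => by
      rw [mem_ball_zero_iff]
      exact hθsR s hs l
  have huc : ∀ l j, ContinuousOn (fun s => u s l j) I := fun l j =>
    hψ.continuousOn.comp (by fun_prop) fun s hs => hcsR s hs l j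
  have hvre : ∀ s ∈ I, ∀ l, -flatDensity e < (v s l).re := fun s hs l =>
    (hφ.spec _ (hθsR s hs l)).1
  have hure : ∀ s ∈ I, ∀ l j, (u s l j).re < -flatDensity e := fun s hs l j =>
    (hψ.spec _ (hcsR s hs l j)).1
  have hv1 : ∀ s ∈ I, ∀ l, 0 < (v s l + 1).re := by
    intro s hs l
    have := hvre s hs l
    simp only [Complex.add_re, Complex.one_re]
    linarith
  have hvρ : ∀ s ∈ I, ∀ l, 0 < (((e : ℂ) + 1) * (v s l + flatDensity e)).re := by
    intro s hs l
    have := hvre s hs l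
    have h1 : ((e : ℂ) + 1) = ((e + 1 : ℝ) : ℂ) := by push_cast; rfl
    rw [h1, Complex.re_ofReal_mul, Complex.add_re, Complex.ofReal_re]
    have : 0 < (v s l).re + flatDensity e := by linarith
    positivity
  have hvu : ∀ s ∈ I, ∀ l m j, 0 < (v s l - u s m j).re := by
    intro s hs l m j
    have h1 := hvre s hs l
    have h2 := hure s hs m j
    rw [Complex.sub_re]
    linarith
  have hvne : ∀ s ∈ I, ∀ l, v s l + 1 ≠ 0 := by
    intro s hs l h
    have := hv1 s hs l
    rw [h] at this
    simp at this
  -- the right roots divided by `s ^ e`, which remain meaningful and distinct at `s = 0`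
  set w : ℝ → Fin N → ℂ := fun s l => θ l * ((v s l + 1) ^ e)⁻¹ with hw
  have hwv : ∀ s ∈ I, ∀ l, v s l = (s : ℂ) ^ e * w s l := by
    intro s hs l
    have h1 := (hφ.spec _ (hθsR s hs l)).2.1
    have h2 := pow_ne_zero e (hvne s hs l)
    simp only [hw]
    rw [← mul_assoc, eq_mul_inv_iff_mul_eq₀ h2]
    exact h1
  set F : ℝ → ℂ := fun s => (∏ l, ∏ m ∈ Finset.Ioi l, (w s m - w s l) / (θ m - θ l)) *
      ∏ l, ∏ m, ∏ j, Complex.sqrt (v s l - u s m j) with hF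
  set G : ℝ → ℂ := fun s => ∏ l, Complex.sqrt (v s l + 1) ^ (e - 1) *
      Complex.sqrt ((e + 1) * (v s l + flatDensity e)) with hG
  have hsqrt : ∀ {f : ℝ → ℂ}, ContinuousOn f I → (∀ s ∈ I, 0 < (f s).re) →
      ContinuousOn (fun s => Complex.sqrt (f s)) I := fun hf hre s hs =>
    (continuousAt_csqrt (hre s hs)).comp_continuousWithinAt (hf s hs)
  have hFc : ContinuousOn F I := by
    refine ContinuousOn.mul ?_ ?_
    · refine continuousOn_finsetProd _ fun l _ => continuousOn_finsetProd _ fun m _ => ?_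
      refine ContinuousOn.div_const (ContinuousOn.sub ?_ ?_) _
      · exact continuousOn_const.mul ((((hvc m).add continuousOn_const).pow e).inv₀
          fun s hs => pow_ne_zero e (hvne s hs m))
      · exact continuousOn_const.mul ((((hvc l).add continuousOn_const).pow e).inv₀
          fun s hs => pow_ne_zero e (hvne s hs l))
    · refine continuousOn_finsetProd _ fun l _ => continuousOn_finsetProd _ fun m _ =>
        continuousOn_finsetProd _ fun j _ => ?_
      exact hsqrt ((hvc l).sub (huc m j)) fun s hs => hvu s hs l m j
  have hGc : ContinuousOn G I := by
    refine continuousOn_finsetProd _ fun l _ => ?_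
    refine ((hsqrt ((hvc l).add continuousOn_const) fun s hs => hv1 s hs l).pow _).mul ?_
    exact hsqrt (continuousOn_const.mul ((hvc l).add continuousOn_const)) fun s hs => hvρ s hs l
  have hG0 : ∀ {s}, s ∈ I → G s ≠ 0 := fun {s} hs =>
    Finset.prod_ne_zero_iff.2 fun l _ => mul_ne_zero
      (pow_ne_zero _ (csqrt_ne_zero (hv1 s hs l))) (csqrt_ne_zero (hvρ s hs l))
  have h0I : (0 : ℝ) ∈ I := ⟨le_rfl, zero_le_one⟩
  have h1I : (1 : ℝ) ∈ I := ⟨zero_le_one, le_rfl⟩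
  have hFG0 : F 0 = G 0 := by
    have hv0 : ∀ l, v 0 l = 0 := by
      intro l
      simp [hv, hθs, he0, hφ.apply_zero he]
    have hu0 : ∀ l j, u 0 l j = -1 := by
      intro l j
      simp [hu, hcs, hψ.apply_zero]
    have h3 : ((e : ℂ) + 1) * flatDensity e = 1 := by
      have h3 : (e : ℂ) + 1 ≠ 0 := by exact_mod_cast Nat.succ_ne_zero e
      unfold flatDensity
      push_cast
      exact mul_inv_cancel₀ h3
    have hF0 : F 0 = 1 := by
      simp only [hF, hw, hv0, hu0, zero_add, one_pow, inv_one, mul_one, zero_sub, neg_neg,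
        Complex.sqrt_one, Finset.prod_const_one]
      refine Finset.prod_eq_one fun l _ => Finset.prod_eq_one fun m hm => div_self ?_
      exact sub_ne_zero.2 fun h => (Finset.mem_Ioi.1 hm).ne' (hθ h)
    have hG1 : G 0 = 1 := by
      simp only [hG, hv0, zero_add, Complex.sqrt_one, one_pow, one_mul, h3, Finset.prod_const_one]
    rw [hF0, hG1]
  have hsq : Set.EqOn (F ^ 2) (G ^ 2) I := by
    intro s hs
    rcases eq_or_ne s 0 with rfl | hs0
    · simp [hFG0]
    · have hse : (s : ℂ) ^ e ≠ 0 := pow_ne_zero e (by exact_mod_cast hs0)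
      have h1 := prod_sub_sq_eq he hφ hψ (θ := θs s) (c := cs s)
        (fun l m h => hθ (mul_left_cancel₀ hse h)) (hθsR s hs) (hcsp s)
        (fun l j j' h => hcinj l (mul_left_cancel₀ (by exact_mod_cast hs0) h))
      have h2 : ∀ l m, (φ (θs s m) - φ (θs s l)) / (θs s m - θs s l) =
          (w s m - w s l) / (θ m - θ l) := by
        intro l m
        change (v s m - v s l) / ((s : ℂ) ^ e * θ m - (s : ℂ) ^ e * θ l) = _
        rw [hwv s hs m, hwv s hs l, ← mul_sub, ← mul_sub, mul_div_mul_left _ _ hse]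
      simp only [h2] at h1
      simp only [Pi.pow_apply, hF, hG]
      rw [mul_pow]
      simp only [← Finset.prod_pow, mul_pow, csqrt_sq]
      simp only [← pow_mul, mul_comm (e - 1) 2]
      simp only [pow_mul, csqrt_sq, Finset.prod_pow]
      exact h1
  have hfin := isPreconnected_Icc.eq_of_sq_eq hFc hGc hsq hG0 h0I hFG0 h1I
  have hθ1 : ∀ l, θs 1 l = θ l := by simp [hθs]
  have hc1 : ∀ l j, cs 1 l j = c l j := by simp [hcs]
  have hw1 : ∀ l, w 1 l = φ (θ l) := by
    intro l
    have := hwv 1 h1I l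
    rw [Complex.ofReal_one, one_pow, one_mul] at this
    rw [← this, ← hθ1 l]
  simp only [hF, hG, hw1, hv, hu, hθ1, hc1] at hfin
  exact hfin

/-- A labelling of the `n`-th roots of a nonzero number. -/
lemma exists_pow_eq_family {n : ℕ} (hn : 1 ≤ n) {a : ℂ} (ha : a ≠ 0) :
    ∃ c : Fin n → ℂ, Function.Injective c ∧ (∀ j, c j ^ n = a) ∧ ∀ x, x ^ n = a → ∃ j, c j = x := by
  obtain ⟨α, hα⟩ := IsAlgClosed.exists_pow_nat_eq a (by omega : 0 < n)
  have hζ := Complex.isPrimitiveRoot_exp n (by omega)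
  set ζ := Complex.exp (2 * Real.pi * Complex.I / n)
  have hα0 : α ≠ 0 := by
    rintro rfl
    rw [zero_pow (by omega)] at hα
    exact ha hα.symm
  refine ⟨fun j => α * ζ ^ (j : ℕ), fun j j' h => ?_, fun j => ?_, fun x hx => ?_⟩
  · exact Fin.ext (hζ.pow_inj j.2 j'.2 (mul_left_cancel₀ hα0 h))
  · rw [mul_pow, hα, ← pow_mul, mul_comm (j : ℕ), pow_mul, hζ.pow_eq_one, one_pow, mul_one]
  · have : NeZero n := ⟨by omega⟩
    have h1 : (x / α) ^ n = 1 := by rw [div_pow, hx, hα, div_self ha]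
    obtain ⟨i, hi, hi'⟩ := hζ.eq_pow_of_pow_eq_one h1
    refine ⟨⟨i, hi⟩, ?_⟩
    simp only [hi']
    field_simp

lemma density_flat (hN : 1 ≤ N) : density N (N * (e + 1)) = flatDensity e := by
  unfold density flatDensity
  have : (0 : ℝ) < N := by exact_mod_cast hN
  push_cast
  field_simp

lemma lt_mul_succ (hN : 1 ≤ N) (he : 1 ≤ e) : N < N * (e + 1) := by nlinarith

lemma criticalRadius_flat (hN : 1 ≤ N) (he : 1 ≤ e) :
    criticalRadius N (N * (e + 1)) ^ (e + 1) = flatRadius e := by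
  have h1 := criticalRadius_pow hN (lt_mul_succ hN he)
  have h2 : N * (e + 1) - N = e * N := by
    rw [mul_add, mul_one, Nat.add_sub_cancel, mul_comm]
  have h3 := criticalRadius_pos hN (lt_mul_succ hN he)
  rw [density_flat hN, h2, pow_mul _ e, ← mul_pow] at h1
  generalize criticalRadius N (N * (e + 1)) = r at h1 h3 ⊢
  rw [mul_comm N, pow_mul] at h1
  exact (pow_left_inj₀ (by positivity) (flatRadius_pos he).le (by omega)).1 h1

lemma mem_betheRoots_flat (hN : 1 ≤ N) (he : 1 ≤ e) {z w : ℂ} :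
    w ∈ betheRoots N (N * (e + 1)) z ↔ (w * (w + 1) ^ e) ^ N = (z ^ (e + 1)) ^ N := by
  have h2 : N * (e + 1) - N = e * N := by
    rw [mul_add, mul_one, Nat.add_sub_cancel, mul_comm]
  rw [mem_betheRoots hN (lt_mul_succ hN he), h2, pow_mul _ e, ← mul_pow, mul_comm N (e + 1),
    pow_mul]

/-- A labelling of the roots of `q_z` for `L = N (e + 1)`: for each of the `N` values `θ l` of
`w (w + 1) ^ e` at the roots there are one right root `v l` and `e` left roots `u l j`. The identity
`prod_csqrt` belongs to the structure because its proof needs the roots as values of branches. -/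
structure FlatRoots (N e : ℕ) (z : ℂ) (θ v : Fin N → ℂ) (u : Fin N → Fin e → ℂ) : Prop where
  theta_injective : Function.Injective θ
  theta_ne_zero : ∀ l, θ l ≠ 0
  right_eq : ∀ l, v l * (v l + 1) ^ e = θ l
  left_eq : ∀ l j, u l j * (u l j + 1) ^ e = θ l
  left_injective : ∀ l, Function.Injective (u l)
  mem_right : ∀ w, w ∈ rightRoots N (N * (e + 1)) z ↔ ∃ l, v l = w
  mem_left : ∀ w, w ∈ leftRoots N (N * (e + 1)) z ↔ ∃ l j, u l j = w
  mem_bethe : ∀ w, w ∈ betheRoots N (N * (e + 1)) z ↔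
    w ∈ rightRoots N (N * (e + 1)) z ∨ w ∈ leftRoots N (N * (e + 1)) z
  disjoint : ∀ w ∈ rightRoots N (N * (e + 1)) z, w ∉ leftRoots N (N * (e + 1)) z
  prod_csqrt : (∏ l, ∏ m ∈ Finset.Ioi l, (v m - v l) / (θ m - θ l)) *
      ∏ l, ∏ m, ∏ j, Complex.sqrt (v l - u m j) =
    ∏ l, Complex.sqrt (v l + 1) ^ (e - 1) * Complex.sqrt ((e + 1) * (v l + flatDensity e))

lemma exists_flatRoots (hN : 1 ≤ N) (he : 1 ≤ e) {z : ℂ} (hz : 0 < ‖z‖)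
    (hzr : ‖z‖ < criticalRadius N (N * (e + 1))) :
    ∃ θ v u, FlatRoots N e z θ v u := by
  obtain ⟨φ, hφ⟩ := exists_rightBranch he
  obtain ⟨ψ, hψ⟩ := exists_leftBranch he
  have hz0 : z ≠ 0 := norm_pos_iff.1 hz
  have ha : (z ^ (e + 1)) ^ N ≠ 0 := pow_ne_zero _ (pow_ne_zero _ hz0)
  obtain ⟨θ, hθinj, hθ, hθsurj⟩ := exists_pow_eq_family hN ha
  have hnorm : ∀ x : ℂ, x ^ N = (z ^ (e + 1)) ^ N → ‖x‖ < flatRadius e := by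
    intro x hx
    have h1 : ‖x‖ ^ N = (‖z‖ ^ (e + 1)) ^ N := by rw [← norm_pow, hx, norm_pow, norm_pow]
    rw [(pow_left_inj₀ (norm_nonneg _) (by positivity) (by omega)).1 h1,
      ← criticalRadius_flat hN he]
    exact pow_lt_pow_left₀ hzr (norm_nonneg _) (by omega)
  have hθR := fun l => hnorm _ (hθ l)
  have hθ0 : ∀ l, θ l ≠ 0 := by
    intro l h
    have := hθ l
    rw [h, zero_pow (by omega)] at this
    exact ha this.symm
  choose c hcinj hc hcsurj using fun l => exists_pow_eq_family he (neg_ne_zero.2 (hθ0 l))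
  have hcR : ∀ l j, ‖c l j‖ ^ e < flatRadius e := fun l j => by
    rw [norm_pow_eq_of_pow_eq (hc l j)]
    exact hθR l
  have hleft : ∀ l j, ψ (c l j) * (ψ (c l j) + 1) ^ e = θ l := fun l j => by
    rw [(hψ.spec _ (hcR l j)).2, hc, neg_neg]
  have hmr : ∀ w, w ∈ rightRoots N (N * (e + 1)) z ↔
      w ∈ betheRoots N (N * (e + 1)) z ∧ -flatDensity e < w.re := fun w => by
    rw [rightRoots, Finset.mem_filter, density_flat hN]
    rfl
  have hml : ∀ w, w ∈ leftRoots N (N * (e + 1)) z ↔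
      w ∈ betheRoots N (N * (e + 1)) z ∧ w.re < -flatDensity e := fun w => by
    rw [leftRoots, Finset.mem_filter, density_flat hN]
    rfl
  have hR' : ∀ w, w ∈ betheRoots N (N * (e + 1)) z → -flatDensity e ≤ w.re →
      ∃ l, φ (θ l) = w := by
    intro w hw hre
    obtain ⟨l, hl⟩ := hθsurj _ ((mem_betheRoots_flat hN he).1 hw)
    exact ⟨l, ((hφ.spec _ (hθR l)).2.2 w hre hl.symm).symm⟩
  have hv := fun l => (hφ.spec _ (hθR l)).2.1
  have hvmem : ∀ l, φ (θ l) ∈ rightRoots N (N * (e + 1)) z := fun l => by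
    rw [hmr, mem_betheRoots_flat hN he, hv, hθ]
    exact ⟨rfl, (hφ.spec _ (hθR l)).1⟩
  refine ⟨θ, fun l => φ (θ l), fun l j => ψ (c l j), hθinj, hθ0, hv, hleft, ?_, ?_, ?_, ?_, ?_,
    prod_csqrt_eq he hφ hψ hθinj hθR hc hcinj⟩
  · exact fun l j j' h => hcinj l (hψ.inj _ _ (hcR l j) (hcR l j') h)
  · intro w
    constructor
    · intro hw
      rw [hmr] at hw
      exact hR' w hw.1 hw.2.le
    · rintro ⟨l, rfl⟩
      exact hvmem l
  · intro w
    rw [hml]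
    constructor
    · rintro ⟨hw, hre⟩
      have hw' := (mem_betheRoots_flat hN he).1 hw
      obtain ⟨l, hl⟩ := hθsurj _ hw'
      obtain ⟨c', hc', rfl⟩ := hψ.surj w hre.le (hnorm _ hw')
      obtain ⟨j, hj⟩ := hcsurj l c' (by rw [hl, ← hc', neg_neg])
      exact ⟨l, j, by rw [hj]⟩
    · rintro ⟨l, j, rfl⟩
      rw [mem_betheRoots_flat hN he, hleft, hθ]
      exact ⟨rfl, (hψ.spec _ (hcR l j)).1⟩
  · intro w
    constructor
    · intro hw
      rcases lt_or_ge w.re (-flatDensity e) with h | h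
      · exact Or.inr ((hml w).2 ⟨hw, h⟩)
      · obtain ⟨l, rfl⟩ := hR' w hw h
        exact Or.inl (hvmem l)
    · rintro (h | h)
      · exact ((hmr w).1 h).1
      · exact ((hml w).1 h).1
  · intro w hw hw'
    exact ((hmr w).1 hw).2.not_gt ((hml w).1 hw').2

end FlatRoots

/-! ### The determinant for the flat initial condition -/

section FlatDet

open Polynomial

variable {N e : ℕ} {z : ℂ} {θ v : Fin N → ℂ} {u : Fin N → Fin e → ℂ}

namespace FlatRoots

lemma right_injective (h : FlatRoots N e z θ v u) : Function.Injective v := fun l l' hl =>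
  h.theta_injective (by rw [← h.right_eq l, ← h.right_eq l', hl])

lemma left_injective' (h : FlatRoots N e z θ v u) :
    Function.Injective fun p : Fin N × Fin e => u p.1 p.2 := by
  rintro ⟨l, j⟩ ⟨l', j'⟩ hp
  simp only at hp
  obtain rfl : l = l' := h.theta_injective (by rw [← h.left_eq l j, ← h.left_eq l' j', hp])
  rw [h.left_injective l hp]

lemma rightRoots_eq (h : FlatRoots N e z θ v u) :
    rightRoots N (N * (e + 1)) z = Finset.univ.image v := by
  ext w
  simp [h.mem_right]

lemma leftRoots_eq (h : FlatRoots N e z θ v u) :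
    leftRoots N (N * (e + 1)) z = Finset.univ.image fun p : Fin N × Fin e => u p.1 p.2 := by
  ext w
  simp [h.mem_left]

lemma right_ne_left (h : FlatRoots N e z θ v u) (l m : Fin N) (j : Fin e) : v l ≠ u m j := fun hl =>
  h.disjoint _ ((h.mem_right _).2 ⟨l, rfl⟩) ((h.mem_left _).2 ⟨m, j, hl.symm⟩)

lemma sum_betheRoots (h : FlatRoots N e z θ v u) (F : ℂ → ℂ) :
    ∑ w ∈ betheRoots N (N * (e + 1)) z, F w = ∑ l, (F (v l) + ∑ j, F (u l j)) := by
  have h1 : betheRoots N (N * (e + 1)) z =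
      rightRoots N (N * (e + 1)) z ∪ leftRoots N (N * (e + 1)) z := by
    ext w
    rw [h.mem_bethe, Finset.mem_union]
  rw [h1, Finset.sum_union (Finset.disjoint_left.2 h.disjoint), h.rightRoots_eq, h.leftRoots_eq,
    Finset.sum_image h.right_injective.injOn, Finset.sum_image h.left_injective'.injOn,
    Fintype.sum_prod_type, Finset.sum_add_distrib]

lemma rightPoly_eq (h : FlatRoots N e z θ v u) :
    rightPoly N (N * (e + 1)) z = Lagrange.nodal Finset.univ v := by
  rw [rightPoly, h.rightRoots_eq, Finset.prod_image h.right_injective.injOn, Lagrange.nodal]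

lemma mem_flatFiber (h : FlatRoots N e z θ v u) {w x : ℂ} :
    x ∈ flatFiber N (e + 1) z w ↔ ∃ l, v l = x ∧ θ l = w * (w + 1) ^ e := by
  rw [flatFiber, Finset.mem_filter, h.mem_right, Nat.add_sub_cancel]
  constructor
  · rintro ⟨⟨l, rfl⟩, hl⟩
    exact ⟨l, rfl, by rw [← hl, h.right_eq]⟩
  · rintro ⟨l, rfl, hl⟩
    exact ⟨⟨l, rfl⟩, by rw [← hl, h.right_eq]⟩

lemma flatPartner_eq (h : FlatRoots N e z θ v u) (l : Fin N) (j : Fin e) :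
    flatPartner N (e + 1) z (u l j) = v l := by
  have h1 : v l ∈ flatFiber N (e + 1) z (u l j) := h.mem_flatFiber.2 ⟨l, rfl, (h.left_eq l j).symm⟩
  obtain ⟨m, hm, hm'⟩ := h.mem_flatFiber.1
    (Classical.epsilon_spec (p := fun x => x ∈ flatFiber N (e + 1) z (u l j)) ⟨_, h1⟩)
  rw [h.left_eq] at hm'
  rw [flatPartner, ← hm, h.theta_injective hm']

lemma existsUnique_flatFiber (h : FlatRoots N e z θ v u) {w : ℂ}
    (hw : w ∈ leftRoots N (N * (e + 1)) z) : ∃! x, x ∈ flatFiber N (e + 1) z w := by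
  obtain ⟨l, j, rfl⟩ := (h.mem_left w).1 hw
  refine ⟨v l, h.mem_flatFiber.2 ⟨l, rfl, (h.left_eq l j).symm⟩, fun x hx => ?_⟩
  obtain ⟨m, rfl, hm⟩ := h.mem_flatFiber.1 hx
  rw [h.left_eq] at hm
  rw [h.theta_injective hm]

lemma card_flatFiber (h : FlatRoots N e z θ v u) {x : ℂ}
    (hx : x ∈ rightRoots N (N * (e + 1)) z) :
    ((leftRoots N (N * (e + 1)) z).filter fun w => x ∈ flatFiber N (e + 1) z w).card = e := by
  obtain ⟨l, rfl⟩ := (h.mem_right x).1 hx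
  have h1 : (leftRoots N (N * (e + 1)) z).filter (fun w => v l ∈ flatFiber N (e + 1) z w) =
      Finset.univ.image (u l) := by
    ext w
    simp only [Finset.mem_filter, Finset.mem_image, Finset.mem_univ, true_and, h.mem_left,
      h.mem_flatFiber]
    constructor
    · rintro ⟨⟨m, j, rfl⟩, m', hm, hm'⟩
      rw [h.left_eq] at hm'
      obtain rfl := h.right_injective hm
      obtain rfl := h.theta_injective hm'
      exact ⟨j, rfl⟩
    · rintro ⟨j, rfl⟩
      exact ⟨⟨l, j, rfl⟩, l, rfl, (h.left_eq l j).symm⟩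
  rw [h1, Finset.card_image_of_injective _ (h.left_injective l), Finset.card_univ, Fintype.card_fin]

lemma mem_betheRoots_right (h : FlatRoots N e z θ v u) (l : Fin N) :
    v l ∈ betheRoots N (N * (e + 1)) z :=
  (h.mem_bethe _).2 (Or.inl ((h.mem_right _).2 ⟨l, rfl⟩))

lemma mem_betheRoots_left (h : FlatRoots N e z θ v u) (l : Fin N) (j : Fin e) :
    u l j ∈ betheRoots N (N * (e + 1)) z :=
  (h.mem_bethe _).2 (Or.inr ((h.mem_left _).2 ⟨l, j, rfl⟩))

/-- The discriminant of `X ^ N - z ^ L`, whose roots are the `θ l`. -/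
lemma prod_theta_sub (hN : 1 ≤ N) (he : 1 ≤ e) (h : FlatRoots N e z θ v u) :
    ∏ l, ∏ m ∈ Finset.Ioi l, (θ l - θ m) * (θ m - θ l) = ∏ l, (N : ℂ) * θ l ^ (N - 1) := by
  have hpow : ∀ l, θ l ^ N = (z ^ (e + 1)) ^ N := fun l => by
    rw [← h.right_eq l]
    exact (mem_betheRoots_flat hN he).1 (h.mem_betheRoots_right l)
  have hnodal : (X ^ N - C ((z ^ (e + 1)) ^ N) : ℂ[X]) = Lagrange.nodal Finset.univ θ := by
    refine Polynomial.eq_of_degree_sub_lt_of_eval_index_eq (v := θ) Finset.univ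
      h.theta_injective.injOn ?_ ?_
    · have hd := degree_X_pow_sub_C (by omega : 0 < N) ((z ^ (e + 1)) ^ N)
      have hm := monic_X_pow_sub_C ((z ^ (e + 1)) ^ N) (by omega : N ≠ 0)
      have hnd : (Lagrange.nodal Finset.univ θ).degree = N := by
        rw [Lagrange.degree_nodal, Finset.card_univ, Fintype.card_fin]
      rw [Finset.card_univ, Fintype.card_fin, ← hd]
      exact degree_sub_lt_left (hd.trans hnd.symm) hm.ne_zero
        (hm.leadingCoeff.trans (Lagrange.nodal_monic).leadingCoeff.symm)
    · intro l _
      rw [Lagrange.eval_nodal_at_node (Finset.mem_univ l)]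
      simp [hpow]
  have h1 := Finset.prod_prod_Ioi_mul_eq_prod_prod_off_diag fun m l : Fin N => θ l - θ m
  rw [h1]
  refine Finset.prod_congr rfl fun l _ => ?_
  have h2 := Lagrange.eval_nodal_derivative_eval_node_eq (v := θ) (Finset.mem_univ l)
  rw [Lagrange.eval_nodal, ← hnodal] at h2
  rw [Finset.compl_singleton, ← h2, derivative_sub, derivative_C, derivative_X_pow]
  simp

end FlatRoots

/-- The weight of a Bethe root in the determinant for the flat initial condition. -/
noncomputable def flatChi (N e : ℕ) (k a : ℤ) (t : ℝ) (w : ℂ) : ℂ :=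
  Complex.exp (t * w) * (w + 1) ^ (k * (e + 1) - a + 1) * w ^ (-((N : ℤ) - 1)) /
    ((N * (e + 1) : ℕ) * (w + flatDensity e))

variable {k a : ℤ} {t : ℝ}

lemma flatChi_ne_zero {w : ℂ} (hN : 1 ≤ N) (he : 1 ≤ e) (hz : 0 < ‖z‖)
    (hzr : ‖z‖ < criticalRadius N (N * (e + 1))) (hw : w ∈ betheRoots N (N * (e + 1)) z) :
    flatChi N e k a t w ≠ 0 := by
  obtain ⟨h1, h2⟩ := ne_zero_of_mem_betheRoots hN (lt_mul_succ hN he) hz hw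
  have h3 := add_density_ne_zero_of_mem_betheRoots hN (lt_mul_succ hN he) hzr hw
  rw [density_flat hN] at h3
  have h4 : ((N * (e + 1) : ℕ) : ℂ) ≠ 0 := by
    exact_mod_cast (Nat.mul_pos hN (Nat.succ_pos e)).ne'
  exact div_ne_zero (mul_ne_zero (mul_ne_zero (Complex.exp_ne_zero _) (zpow_ne_zero _ h2))
    (zpow_ne_zero _ h1)) (mul_ne_zero h4 h3)

/-- The function `g` in the definition of `flatWeight`, in terms of `flatChi` and of
`θ = w (w + 1) ^ (d - 1)`, which two partners share. -/
lemma flatWeight_factor {w : ℂ} (hN : 1 ≤ N) (he : 1 ≤ e) (hz : 0 < ‖z‖)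
    (hw : w ∈ betheRoots N (N * (e + 1)) z) :
    w ^ (-(N : ℤ) - k + 2) * (w + 1) ^ (-a + k + ((e + 1 : ℕ) : ℤ)) * Complex.exp (t * w) /
      (w + density N (N * (e + 1))) =
    (N * (e + 1) : ℕ) * flatChi N e k a t w * (w * (w + 1) ^ e) ^ (1 - k) := by
  obtain ⟨h1, h2⟩ := ne_zero_of_mem_betheRoots hN (lt_mul_succ hN he) hz hw
  have h4 : ((N * (e + 1) : ℕ) : ℂ) ≠ 0 := by
    exact_mod_cast (Nat.mul_pos hN (Nat.succ_pos e)).ne'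
  have h5 : w ^ (-(N : ℤ) - k + 2) = w ^ (-((N : ℤ) - 1)) * w ^ (1 - k) := by
    rw [← zpow_add₀ h1]
    congr 1
    ring
  have h6 : (w + 1) ^ (-a + k + ((e + 1 : ℕ) : ℤ)) =
      (w + 1) ^ (k * (e + 1) - a + 1) * ((w + 1) ^ e) ^ (1 - k) := by
    rw [← zpow_natCast (w + 1) e, ← zpow_mul, ← zpow_add₀ h2]
    congr 1
    push_cast
    ring
  rw [h5, h6, density_flat hN, flatChi, mul_zpow]
  rw [← mul_div_assoc, mul_div_mul_left _ _ h4]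
  ring

lemma flatWeight_left (hN : 1 ≤ N) (he : 1 ≤ e) (hz : 0 < ‖z‖) (h : FlatRoots N e z θ v u)
    (l : Fin N) (j : Fin e) :
    flatWeight N (e + 1) k a t z (u l j) =
      (rightPoly N (N * (e + 1)) z).eval (u l j) * ((N * (e + 1) : ℕ) *
        flatChi N e k a t (u l j) * θ l ^ (1 - k)) := by
  have h1 := flatWeight_factor (k := k) (a := a) (t := t) hN he hz (h.mem_betheRoots_left l j)
  rw [h.left_eq] at h1
  rw [flatWeight, if_pos ((h.mem_left _).2 ⟨l, j, rfl⟩), ← h1]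
  ring

lemma flatWeight_right (hN : 1 ≤ N) (he : 1 ≤ e) (hz : 0 < ‖z‖) (h : FlatRoots N e z θ v u)
    (l : Fin N) :
    flatWeight N (e + 1) k a t z (v l) =
      (derivative (rightPoly N (N * (e + 1)) z)).eval (v l) * ((N * (e + 1) : ℕ) *
        flatChi N e k a t (v l) * θ l ^ (1 - k)) := by
  have h1 := flatWeight_factor (k := k) (a := a) (t := t) hN he hz (h.mem_betheRoots_right l)
  rw [h.right_eq] at h1
  rw [flatWeight, if_neg (h.disjoint _ ((h.mem_right _).2 ⟨l, rfl⟩)), ← h1]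
  ring

/-- The terms of the sum over the right roots alone. -/
noncomputable def rightMatrix (e : ℕ) (k a : ℤ) (t : ℝ) (v : Fin N → ℂ) :
    Matrix (Fin N) (Fin N) ℂ :=
  Matrix.of fun i l => flatChi N e k a t (v l) * v l ^ (i.rev : ℕ)

lemma det_rightMatrix (v : Fin N → ℂ) :
    (rightMatrix e k a t v).det =
      (∏ l, flatChi N e k a t (v l)) * ∏ l, ∏ m ∈ Finset.Ioi l, (v l - v m) := by
  have h1 := Matrix.det_projVandermonde (fun _ : Fin N => (1 : ℂ)) v
  simp only [one_mul] at h1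
  rw [← h1, ← Matrix.det_transpose (rightMatrix e k a t v), ← Matrix.det_mul_column]
  congr 1
  ext l i
  simp [rightMatrix, Matrix.projVandermonde_apply]

/-- Adding the terms of the left roots to the columns of `rightMatrix` multiplies the determinant
by the Fredholm determinant of the kernel. Lagrange interpolation at the right roots expresses the
powers of the left roots by those of the right roots, so the columns are multiplied by a matrix
`1 + Y P`, and the kernel is the transpose of `P Y`. -/
lemma det_add_left (hN : 1 ≤ N) (he : 1 ≤ e) (hz : 0 < ‖z‖)
    (hzr : ‖z‖ < criticalRadius N (N * (e + 1))) (h : FlatRoots N e z θ v u) :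
    (Matrix.of fun i l : Fin N => flatChi N e k a t (v l) * v l ^ (i.rev : ℕ) +
      ∑ j, flatChi N e k a t (u l j) * u l j ^ (i.rev : ℕ)).det =
    (rightMatrix e k a t v).det * (1 + flatKernel N (e + 1) k a t z).det := by
  set Q := rightPoly N (N * (e + 1)) z with hQ
  have hQn : Q = Lagrange.nodal Finset.univ v := h.rightPoly_eq
  set χ := flatChi N e k a t with hχ
  have hL : ((N * (e + 1) : ℕ) : ℂ) ≠ 0 := by
    exact_mod_cast (Nat.mul_pos hN (Nat.succ_pos e)).ne'
  have hχv : ∀ l, χ (v l) ≠ 0 := fun l =>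
    flatChi_ne_zero hN he hz hzr (h.mem_betheRoots_right l)
  have hinterp : ∀ (l : Fin N) (j : Fin e) (m : ℕ), m < N → u l j ^ m =
      ∑ l', v l' ^ m * (Q.eval (u l j) * (((derivative Q).eval (v l'))⁻¹ * (u l j - v l')⁻¹)) := by
    intro l j m hm
    have h1 := Lagrange.eq_interpolate (s := Finset.univ) (v := v) h.right_injective.injOn
      (f := X ^ m) (by
        rw [degree_X_pow, Finset.card_univ, Fintype.card_fin]
        exact_mod_cast hm)
    have h2 := congrArg (eval (u l j)) h1
    rw [Lagrange.interpolate_apply, eval_finsetSum] at h2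
    simp only [eval_mul, eval_C, eval_pow, eval_X] at h2
    rw [h2]
    refine Finset.sum_congr rfl fun l' _ => ?_
    rw [Lagrange.eval_basis_not_at_node (Finset.mem_univ l') (h.right_ne_left l' l j).symm,
      Lagrange.nodalWeight_eq_eval_derivative_nodal (Finset.mem_univ l'), hQn]
  let P : Matrix (leftRoots N (N * (e + 1)) z) (Fin N) ℂ := Matrix.of fun x l =>
    if x.1 * (x.1 + 1) ^ e = θ l then θ l ^ (k - 1) else 0
  let Y : Matrix (Fin N) (leftRoots N (N * (e + 1)) z) ℂ := Matrix.of fun l x =>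
    χ x.1 * (x.1 * (x.1 + 1) ^ e) ^ (1 - k) * (χ (v l))⁻¹ *
      (Q.eval x.1 * (((derivative Q).eval (v l))⁻¹ * (x.1 - v l)⁻¹))
  have hsumS : ∀ F : ℂ → ℂ, ∑ x : leftRoots N (N * (e + 1)) z, F x.1 = ∑ l, ∑ j, F (u l j) := by
    intro F
    rw [Finset.sum_coe_sort (leftRoots N (N * (e + 1)) z) F, h.leftRoots_eq,
      Finset.sum_image h.left_injective'.injOn, Fintype.sum_prod_type]
  have hA : (Matrix.of fun i l : Fin N => χ (v l) * v l ^ (i.rev : ℕ) +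
      ∑ j, χ (u l j) * u l j ^ (i.rev : ℕ)) = rightMatrix e k a t v * (1 + Y * P) := by
    rw [mul_add, mul_one, ← Matrix.mul_assoc]
    ext i l
    rw [Matrix.add_apply]
    change _ = χ (v l) * v l ^ (i.rev : ℕ) + _
    rw [Matrix.of_apply, Matrix.mul_apply]
    congr 1
    -- the summand as a function on `ℂ` rather than on the subtype of left roots
    obtain ⟨G, hG⟩ : ∃ G : ℂ → ℂ, ∀ w, G w = (∑ l', χ (v l') * v l' ^ (i.rev : ℕ) *
        (χ w * (w * (w + 1) ^ e) ^ (1 - k) * (χ (v l'))⁻¹ *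
          (Q.eval w * (((derivative Q).eval (v l'))⁻¹ * (w - v l')⁻¹)))) *
          if w * (w + 1) ^ e = θ l then θ l ^ (k - 1) else 0 := ⟨_, fun _ => rfl⟩
    have h3 : ∀ x : leftRoots N (N * (e + 1)) z,
        (rightMatrix e k a t v * Y) i x * P x l = G x.1 := by
      intro x
      rw [Matrix.mul_apply, hG]
      rfl
    rw [Finset.sum_congr rfl fun x _ => h3 x, hsumS G, Finset.sum_eq_single l]
    · refine Finset.sum_congr rfl fun j _ => ?_
      simp only [hG, h.left_eq, if_true]
      rw [hinterp l j _ i.rev.2, Finset.mul_sum, Finset.sum_mul]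
      refine Finset.sum_congr rfl fun l' _ => ?_
      have h4 : θ l ^ (1 - k) * θ l ^ (k - 1) = 1 := by
        rw [← zpow_add₀ (h.theta_ne_zero l)]
        simp
      have h5 := mul_inv_cancel₀ (hχv l')
      linear_combination (-(χ (u l j) * v l' ^ (i.rev : ℕ) *
        (Q.eval (u l j) * (((derivative Q).eval (v l'))⁻¹ * (u l j - v l')⁻¹)))) *
        (h4 + θ l ^ (1 - k) * θ l ^ (k - 1) * h5)
    · intro l' _ hl'
      refine Finset.sum_eq_zero fun j _ => ?_
      simp only [hG, h.left_eq]
      rw [if_neg fun hh => hl' (h.theta_injective hh), mul_zero]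
    · simp
  have hK : (flatKernel N (e + 1) k a t z).transpose = P * Y := by
    ext x x'
    obtain ⟨l, j, hx⟩ := (h.mem_left x.1).1 x.2
    obtain ⟨l', j', hx'⟩ := (h.mem_left x'.1).1 x'.2
    rw [Matrix.transpose_apply, flatKernel, Matrix.of_apply, Matrix.mul_apply,
      Finset.sum_eq_single l]
    · simp only [P, Y, Matrix.of_apply]
      rw [← hx, ← hx', h.flatPartner_eq, flatWeight_left hN he hz h, flatWeight_right hN he hz h,
        h.left_eq, if_pos rfl, h.left_eq]
      have h6 : θ l ^ (k - 1) = (θ l ^ (1 - k))⁻¹ := by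
        rw [← zpow_neg]
        congr 1
        ring
      rw [h6, div_eq_mul_inv]
      simp only [mul_inv]
      have h7 := mul_inv_cancel₀ hL
      linear_combination (Q.eval (u l' j') * χ (u l' j') * θ l' ^ (1 - k) *
        (u l' j' - v l)⁻¹ * ((derivative Q).eval (v l))⁻¹ * (χ (v l))⁻¹ * (θ l ^ (1 - k))⁻¹) * h7
    · intro m _ hm
      simp only [P, Matrix.of_apply]
      rw [← hx, h.left_eq, if_neg fun hh => hm (h.theta_injective hh).symm, zero_mul]
    · simp
  rw [hA, Matrix.det_mul, Matrix.det_one_add_mul_comm, ← hK,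
    ← Matrix.det_transpose (1 + flatKernel N (e + 1) k a t z), Matrix.transpose_add,
    Matrix.transpose_one]

/-- The determinant that belongs to the right roots is the prefactor of the formula. -/
lemma flatConst_eq (hN : 1 ≤ N) (he : 1 ≤ e) (hz : 0 < ‖z‖)
    (hzr : ‖z‖ < criticalRadius N (N * (e + 1))) (h : FlatRoots N e z θ v u) :
    flatConst N (e + 1) k a t z = (rightMatrix e k a t v).det * (Matrix.vandermonde θ).det := by
  have hL : ((N * (e + 1) : ℕ) : ℂ) ≠ 0 := by
    exact_mod_cast (Nat.mul_pos hN (Nat.succ_pos e)).ne'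
  have hS : ∏ l, ∏ m, ∏ j, Complex.sqrt (v l - u m j) ≠ 0 := by
    refine Finset.prod_ne_zero_iff.2 fun l _ => Finset.prod_ne_zero_iff.2 fun m _ =>
      Finset.prod_ne_zero_iff.2 fun j _ hs => ?_
    have := csqrt_sq (v l - u m j)
    rw [hs, zero_pow two_ne_zero] at this
    exact h.right_ne_left l m j (sub_eq_zero.1 this.symm)
  have hdet : (rightMatrix e k a t v).det * (Matrix.vandermonde θ).det =
      (∏ l, flatChi N e k a t (v l) * (N * θ l ^ (N - 1))) *
        ∏ l, ∏ m ∈ Finset.Ioi l, (v m - v l) / (θ m - θ l) := by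
    have hv : (∏ l, ∏ m ∈ Finset.Ioi l, (v l - v m)) * ∏ l, ∏ m ∈ Finset.Ioi l, (θ m - θ l) =
        (∏ l, (N : ℂ) * θ l ^ (N - 1)) *
          ∏ l, ∏ m ∈ Finset.Ioi l, (v m - v l) / (θ m - θ l) := by
      rw [← h.prod_theta_sub hN he, ← Finset.prod_mul_distrib, ← Finset.prod_mul_distrib]
      refine Finset.prod_congr rfl fun l _ => ?_
      rw [← Finset.prod_mul_distrib, ← Finset.prod_mul_distrib]
      refine Finset.prod_congr rfl fun m hm => ?_
      have : θ m - θ l ≠ 0 := sub_ne_zero.2 fun hh =>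
        (Finset.mem_Ioi.1 hm).ne' (h.theta_injective hh)
      field_simp
      ring
    rw [det_rightMatrix, Matrix.det_vandermonde, Finset.prod_mul_distrib, mul_assoc, hv, mul_assoc]
  have hleft : ∀ x : ℂ, ∏ w ∈ leftRoots N (N * (e + 1)) z, Complex.sqrt (x - w) =
      ∏ m, ∏ j, Complex.sqrt (x - u m j) := by
    intro x
    rw [h.leftRoots_eq, Finset.prod_image h.left_injective'.injOn, Fintype.prod_prod_type]
  rw [hdet, flatConst, h.rightRoots_eq, Finset.prod_image h.right_injective.injOn,
    Finset.prod_image h.right_injective.injOn]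
  simp only [hleft]
  rw [div_eq_iff hS, mul_assoc, h.prod_csqrt, ← Finset.prod_mul_distrib]
  refine Finset.prod_congr rfl fun l _ => ?_
  have hmem := h.mem_betheRoots_right l
  obtain ⟨h1, h2⟩ := ne_zero_of_mem_betheRoots hN (lt_mul_succ hN he) hz hmem
  have h3 := add_density_ne_zero_of_mem_betheRoots hN (lt_mul_succ hN he) hzr hmem
  rw [density_flat hN] at h3 ⊢
  have he1 : (e : ℂ) + 1 ≠ 0 := by exact_mod_cast Nat.succ_ne_zero e
  have hs1 : Complex.sqrt (v l + 1) ≠ 0 := by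
    intro hs
    have := csqrt_sq (v l + 1)
    rw [hs, zero_pow two_ne_zero] at this
    exact h2 this.symm
  set b := Complex.sqrt ((e + 1) * (v l + flatDensity e)) with hb
  have hb2 : b ^ 2 = (e + 1) * (v l + flatDensity e) := csqrt_sq _
  have hb0 : b ≠ 0 := by
    intro hs
    rw [hs, zero_pow two_ne_zero] at hb2
    exact mul_ne_zero he1 h3 hb2.symm
  set s := Complex.sqrt (v l + 1) with hsdef
  have hs2 : v l + 1 = s ^ 2 := (csqrt_sq _).symm
  have hNc : (N : ℂ) ≠ 0 := by exact_mod_cast (by omega : N ≠ 0)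
  have hexp : s ^ (2 * (-a + k * ((e + 1 : ℕ) : ℤ) + ((N * (e + 1) : ℕ) : ℤ) - N + 1) -
      ((e + 1 : ℕ) : ℤ)) =
      (s ^ 2) ^ (k * (e + 1) - a + 1) * ((s ^ 2) ^ e) ^ (N - 1) * s ^ (e - 1) := by
    rw [← pow_mul, ← pow_mul, ← zpow_natCast s 2, ← zpow_mul, ← zpow_natCast, ← zpow_natCast,
      ← zpow_add₀ hs1, ← zpow_add₀ hs1]
    congr 1
    push_cast [Nat.cast_sub hN, Nat.cast_sub he]
    ring
  have hvN : v l ^ (-((N : ℤ) - 1)) * v l ^ (N - 1) = 1 := by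
    rw [← zpow_natCast, ← zpow_add₀ h1, Nat.cast_sub hN]
    simp
  have hcast : (((e + 1 : ℕ) : ℂ)) = (e : ℂ) + 1 := by push_cast; rfl
  rw [hcast, ← hb, hexp, flatChi, ← h.right_eq l, mul_pow, hs2]
  have hden : ((N * (e + 1) : ℕ) : ℂ) * (v l + flatDensity e) = N * b ^ 2 := by
    rw [hb2]
    push_cast
    ring
  rw [hden]
  set E := (s ^ 2) ^ (k * ((e : ℤ) + 1) - a + 1)
  set V := v l ^ (-((N : ℤ) - 1))
  field_simp
  linear_combination (-E) * hvN

end FlatDet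

/-! ### The formula for the flat initial condition -/

section Flat

/-- The determinantal solution of the backward equation at the flat configuration, relabelled so that
particle `k` comes first. In each entry the column index `j` occurs only in the power `θ ^ j` of
`θ = w (w + 1) ^ (d - 1)`, so the matrix is a product with the Vandermonde matrix of the `θ l`. -/
lemma waveDet_flat {n e : ℕ} (he : 1 ≤ e) {z : ℂ} (hz : 0 < ‖z‖)
    (hzr : ‖z‖ < criticalRadius (n + 1) ((n + 1) * (e + 1))) (k a : ℤ) (t : ℝ)
    {y : Fin (n + 1) → ℤ} (hy : ∀ j, y j = (j + k) * (e + 1)) :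
    waveDet ((n + 1) * (e + 1)) a t y z =
      flatConst (n + 1) (e + 1) k a t z * (1 + flatKernel (n + 1) (e + 1) k a t z).det := by
  have hN : 1 ≤ n + 1 := by omega
  have hNL := lt_mul_succ hN he
  obtain ⟨θ, v, u, h⟩ := exists_flatRoots hN he hz hzr
  have hentry : ∀ i j : Fin (n + 1), ∀ w ∈ betheRoots (n + 1) ((n + 1) * (e + 1)) z,
      betheWeight (n + 1) ((n + 1) * (e + 1)) w * (Complex.exp (t * w) *
        (w ^ ((j : ℤ) - i - 1) * (w + 1) ^ (y j - j - a))) =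
      flatChi (n + 1) e k a t w * w ^ (i.rev : ℕ) * (w * (w + 1) ^ e) ^ (j : ℕ) := by
    intro i j w hw
    obtain ⟨h1, h2⟩ := ne_zero_of_mem_betheRoots hN hNL hz hw
    have hrev : ((i.rev : ℕ) : ℤ) = n - i := by
      have := i.2
      rw [Fin.val_rev]
      omega
    have h3 : w * w ^ ((j : ℤ) - i - 1) =
        w ^ (-(((n + 1 : ℕ) : ℤ) - 1)) * w ^ (i.rev : ℕ) * w ^ (j : ℕ) := by
      rw [← zpow_natCast w i.rev, ← zpow_natCast w j, ← zpow_add₀ h1, ← zpow_add₀ h1,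
        ← zpow_one_add₀ h1, hrev]
      congr 1
      push_cast
      ring
    have h4 : (w + 1) * (w + 1) ^ (y j - j - a) =
        (w + 1) ^ (k * (e + 1) - a + 1) * ((w + 1) ^ e) ^ (j : ℕ) := by
      rw [← pow_mul, ← zpow_natCast (w + 1), ← zpow_add₀ h2, ← zpow_one_add₀ h2, hy]
      congr 1
      push_cast
      ring
    rw [betheWeight, flatChi, density_flat hN, mul_pow, div_mul_eq_mul_div, div_mul_eq_mul_div,
      div_mul_eq_mul_div]
    congr 1
    calc w * (w + 1) * (Complex.exp (t * w) * (w ^ ((j : ℤ) - i - 1) * (w + 1) ^ (y j - j - a)))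
        = Complex.exp (t * w) * (w * w ^ ((j : ℤ) - i - 1)) *
            ((w + 1) * (w + 1) ^ (y j - j - a)) := by ring
      _ = _ := by
        rw [h3, h4]
        ring
  have hmat : (Matrix.of fun i j : Fin (n + 1) => betheSum (n + 1) ((n + 1) * (e + 1)) z fun w =>
      Complex.exp (t * w) * (w ^ ((j : ℤ) - i - 1) * (w + 1) ^ (y j - j - a))) =
      (Matrix.of fun i l : Fin (n + 1) => flatChi (n + 1) e k a t (v l) * v l ^ (i.rev : ℕ) +
        ∑ j, flatChi (n + 1) e k a t (u l j) * u l j ^ (i.rev : ℕ)) * Matrix.vandermonde θ := by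
    ext i j
    rw [Matrix.of_apply, betheSum, Finset.sum_congr rfl (hentry i j), h.sum_betheRoots,
      Matrix.mul_apply]
    refine Finset.sum_congr rfl fun l _ => ?_
    simp only [Matrix.of_apply, Matrix.vandermonde_apply, h.right_eq, h.left_eq]
    rw [add_mul, Finset.sum_mul]
  rw [waveDet, hmat, Matrix.det_mul, det_add_left hN he hz hzr h, flatConst_eq hN he hz hzr h]
  ring

end Flat

end PeriodicTASEP

open PeriodicTASEP in
theorem theorem7p1 (N d : ℕ) (hN : 1 ≤ N) (hd : 2 ≤ d)
    {Ω : Type*} {m : MeasurableSpace Ω} (μ : Measure Ω) [IsProbabilityMeasure μ]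
    (ℱ : Filtration ℝ≥0 m) (X : ℝ≥0 → Ω → PeriodicTASEP.Config N (N * d))
    (hX : PeriodicTASEP.IsTASEP μ ℱ X)
    (hX0 : ∀ᵐ ω ∂μ, ∀ j : Fin N, (X 0 ω).1 j = ((j : ℤ) + 1) * d)
    (k : ℕ) (hk : 1 ≤ k) (hkN : k ≤ N) (t : ℝ≥0) (ht : 0 < t) (a : ℤ) :
    (∀ z : ℂ, 0 < ‖z‖ → ‖z‖ < PeriodicTASEP.criticalRadius N (N * d) →
      (∀ u ∈ PeriodicTASEP.leftRoots N (N * d) z, ∃! v, v ∈ PeriodicTASEP.flatFiber N d z u) ∧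
      (∀ v ∈ PeriodicTASEP.rightRoots N (N * d) z,
        ((PeriodicTASEP.leftRoots N (N * d) z).filter
          fun u => v ∈ PeriodicTASEP.flatFiber N d z u).card = d - 1)) ∧
    ∀ (p : ℂ) (γ : Path p p),
      PeriodicTASEP.IsContourAroundZero (PeriodicTASEP.criticalRadius N (N * d)) γ →
      CurveIntegrable (PeriodicTASEP.logForm fun z =>
        PeriodicTASEP.flatConst N d k a t z * (1 + PeriodicTASEP.flatKernel N d k a t z).det) γ ∧
      ((μ.real {ω | a ≤ (X t ω).1 ⟨k - 1, by omega⟩} : ℝ) : ℂ) =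
        curveIntegral (PeriodicTASEP.logForm fun z =>
          PeriodicTASEP.flatConst N d k a t z * (1 + PeriodicTASEP.flatKernel N d k a t z).det) γ := by
  obtain ⟨n, rfl⟩ : ∃ n, N = n + 1 := ⟨N - 1, by omega⟩
  obtain ⟨e, rfl⟩ : ∃ e, d = e + 1 := ⟨d - 1, by omega⟩
  have he : 1 ≤ e := by omega
  refine ⟨fun z hz hzr => ?_, fun p γ hγ => ?_⟩
  · obtain ⟨θ, v, u, h⟩ := exists_flatRoots hN he hz hzr
    exact ⟨fun w hw => h.existsUnique_flatFiber hw, fun x hx => h.card_flatFiber hx⟩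
  · have hNL := lt_mul_succ hN he
    have hL : 1 ≤ (n + 1) * (e + 1) := by omega
    -- the flat configuration, and its relabelling which starts with particle `k`
    obtain ⟨ω₀, hω₀⟩ := hX0.exists
    set x₀ := X 0 ω₀ with hx₀
    have h0 : ∀ᵐ ω ∂μ, X 0 ω = x₀ := by
      filter_upwards [hX0] with ω hω
      refine Subtype.ext (funext fun j => ?_)
      rw [hω, hω₀]
    set y := (rotate hL)^[k - 1] x₀ with hy
    have hyj : ∀ j, y.1 j = ((j : ℤ) + k) * ((e : ℤ) + 1) := by
      intro j
      have hj := j.2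
      rw [hy, rotate_iterate_apply hL x₀ (k - 1) (by omega)]
      split_ifs with h
      · rw [hω₀]
        push_cast [Nat.cast_sub hk]
        ring
      · rw [hω₀]
        push_cast [Nat.cast_sub hk, Nat.cast_sub (by omega : n + 1 ≤ (j : ℕ) + (k - 1))]
        ring
    set f : Config (n + 1) ((n + 1) * (e + 1)) → ℝ :=
      firstGE n ((n + 1) * (e + 1)) a ∘ (rotate hL)^[k - 1] with hf
    have hfb : ∀ x, |f x| ≤ 1 := by
      intro x
      simp only [hf, Function.comp, firstGE]
      split_ifs <;> simp
    have hfval : ∀ x, f x = if a ≤ x.1 ⟨k - 1, by omega⟩ then 1 else 0 := by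
      intro x
      simp only [hf, Function.comp, firstGE]
      rw [rotate_iterate_apply hL x (k - 1) (by omega), dif_pos (by simp; omega)]
      simp
    obtain ⟨hcont, hsum⟩ := waveDet_contourMean hNL hγ a t y
    have hEq : ∀ z ∈ Set.range γ, flatConst (n + 1) (e + 1) k a t z *
        (1 + flatKernel (n + 1) (e + 1) k a t z).det =
        waveDet ((n + 1) * (e + 1)) a t y.1 z := by
      rintro _ ⟨s, rfl⟩
      exact (waveDet_flat he (hγ.mem s).1 (hγ.mem s).2 k a t hyj).symm
    have hmean : HasContourMean γ (fun z => flatConst (n + 1) (e + 1) k a t z *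
        (1 + flatKernel (n + 1) (e + 1) k a t z).det)
        (curveIntegral (logForm (waveDet ((n + 1) * (e + 1)) a t y.1)) γ) :=
      HasContourMean.congr ⟨hcont, rfl⟩ fun s => hEq _ ⟨s, rfl⟩
    refine ⟨hγ.curveIntegrable hmean.1, ?_⟩
    rw [hmean.2]
    have hre := Complex.reCLM.hasSum hsum
    have hS : HasSum (fun m : ℕ => (t : ℝ) ^ m / m.factorial * generator^[m] f x₀)
        (curveIntegral (logForm (waveDet ((n + 1) * (e + 1)) a t y.1)) γ).re := by
      refine hre.congr_fun fun m => ?_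
      rw [hf, generator_iterate_comp_rotate]
      simp only [Complex.reCLM_apply, Complex.ofReal_re, Function.comp_apply, hy]
    have hreal := hX.hasSum_generator_iterate h0 hfb t hS
    -- the series has real terms, so the contour integral is real
    have hJ : ((curveIntegral (logForm (waveDet ((n + 1) * (e + 1)) a t y.1)) γ).re : ℂ) =
        curveIntegral (logForm (waveDet ((n + 1) * (e + 1)) a t y.1)) γ := by
      have h1 := Complex.ofRealCLM.hasSum hre
      exact h1.unique hsum
    -- `f` is the indicator function of the event
    have hprob : μ.real {ω | a ≤ (X t ω).1 ⟨k - 1, by omega⟩} = ∫ ω, f (X t ω) ∂μ := by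
      have hmeas : MeasurableSet {ω | a ≤ (X t ω).1 ⟨k - 1, by omega⟩} := by
        have h1 : Measurable fun ω => f (X t ω) :=
          (measurable_config f).comp ((hX.adapted t).mono (ℱ.le t) le_rfl)
        have h2 : {ω | a ≤ (X t ω).1 ⟨k - 1, by omega⟩} = (fun ω => f (X t ω)) ⁻¹' {1} := by
          ext ω
          simp [hfval]
        rw [h2]
        exact h1 (measurableSet_singleton 1)
      rw [← integral_indicator_one hmeas]
      refine integral_congr_ae (Filter.Eventually.of_forall fun ω => ?_)
      simp only [hfval, Set.indicator_apply, Set.mem_ofPred_eq, Pi.one_apply]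
    rw [hprob, hreal, hJ]
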